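/- \textbf{Proposition (Measurable optimal path map).} Let $\mathcal C=[-1,1]^n\subset\mathbb R^n$ with the Euclidean norm, let $\mathcal H^1$ be the one-dimensional Hausdorff measure and $I=[0,1]$. Let $S\subset\mathcal C$ be Borel measurable and countably $1$-rectifiable (a countable union of Lipschitz images of bounded subsets of $\mathbb R$), let $a\in[0,\infty]$, and let $b:S\to[0,\infty)$ be lower semi-continuous with $b\le a$ on $S$. Write $S_\lambda=\{z\in S: b(z)\le\lambda\}$ and assume that $\mathcal H^1(S_\lambda)<\infty$ for all $\lambda\in[0,a)$. Extend $b$ by the value $a$ outside $S$ (with $0\cdot\infty=0$ in products and integrals). For $x,y\in\mathcal C$ let $$d_{S,a,b}(x,y)=\inf_{\gamma}\Big(\int_{\gamma(I)\cap S}b\,\mathrm d\mathcal H^1+a\,\mathcal H^1(\gamma(I)\setminus S)\Big)\in[0,\infty],$$ the infimum being over all Lipschitz paths $\gamma:I\to\mathbb R^n$ with $\gamma(0)=x$ and $\gamma(1)=y$. Let $\Gamma$ be the set of Lipschitz paths $\gamma:I\to\mathcal C$, and for $\gamma\in\Gamma$ put $$L(\gamma)=\int_I b(\gamma(t))\,|\dot\gamma(t)|\,\mathrm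 dt,\qquad \mathrm{len}(\gamma)=\int_I|\dot\gamma(t)|\,\mathrm dt.$$ Let $$d_\Theta(\gamma_1,\gamma_2)=\inf\Big\{\sup_{t\in I}|\gamma_1(t)-\gamma_2(\varphi(t))|\ :\ \varphi:I\to I\text{ increasing and bijective}\Big\},$$ and let $\Theta$ be the set of equivalence classes of $\Gamma$ under $\gamma_1\sim\gamma_2\Leftrightarrow d_\Theta(\gamma_1,\gamma_2)=0$, with the metric induced by $d_\Theta$ and its Borel $\sigma$-algebra. For $\lambda\in[0,\infty]$ let $$C_\lambda=\begin{cases}\mathcal H^1(S_1)+\lambda & \text{if } a=\infty,\\ \mathcal H^1(S_{a/2})+\tfrac2a\lambda&\text{if } a<\infty,\end{cases}$$ with values in $[0,\infty]$ and with $\tfrac20=\infty$. Then there is a Borel measurable map $\rho:\mathcal C\times\mathcal C\to\Theta$ such that for all $x,y\in\mathcal C$ and every representative $\gamma\in\Gamma$ of the class $\rho(x,y)$ we have $$L(\gamma)=d_{S,a,b}(x,y),\qquad \gamma(0)=x,\qquad \gamma(1)=y,\qquad \mathrm{len}(\gamma)\le C_{d_{S,a,b}(x,y)+1}.$$ -/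

import Mathlib

open Set MeasureTheory
open scoped NNReal ENNReal unitInterval

noncomputable section

namespace UrbanMetric

/-- The cube `[-1,1]ⁿ` in Euclidean `n`-space. -/
def cube (n : ℕ) : Set (EuclideanSpace ℝ (Fin n)) :=
  {x | ∀ i, x i ∈ Icc (-1 : ℝ) 1}

/-- `S ⊆ ℝⁿ` is countably `1`-rectifiable: a countable union of Lipschitz images of bounded
subsets of the line. -/
def CountablyOneRectifiable {n : ℕ} (S : Set (EuclideanSpace ℝ (Fin n))) : Prop :=
  ∃ (A : ℕ → Set ℝ) (f : ℕ → ℝ → EuclideanSpace ℝ (Fin n)),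
    (∀ i, Bornology.IsBounded (A i)) ∧
    (∀ i, ∃ K : ℝ≥0, LipschitzOnWith K (f i) (A i)) ∧
    S = ⋃ i, f i '' A i

/-- The part of the network `S` whose friction coefficient is at most `l`. -/
def sublevel {n : ℕ} (S : Set (EuclideanSpace ℝ (Fin n)))
    (b : EuclideanSpace ℝ (Fin n) → ℝ≥0) (l : ℝ≥0∞) : Set (EuclideanSpace ℝ (Fin n)) :=
  {z | z ∈ S ∧ (b z : ℝ≥0∞) ≤ l}

open Classical in
/-- The friction coefficient extended by the value `a` off the network; only the values of `b`
on `S` matter. -/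
def friction {n : ℕ} (S : Set (EuclideanSpace ℝ (Fin n))) (a : ℝ≥0∞)
    (b : EuclideanSpace ℝ (Fin n) → ℝ≥0) (z : EuclideanSpace ℝ (Fin n)) : ℝ≥0∞ :=
  if z ∈ S then (b z : ℝ≥0∞) else a

/-- All Lipschitz paths `[0,1] → ℝⁿ` from `x` to `y`. -/
def connectingPaths {n : ℕ} (x y : EuclideanSpace ℝ (Fin n)) :
    Set (I → EuclideanSpace ℝ (Fin n)) :=
  {γ | (∃ K : ℝ≥0, LipschitzWith K γ) ∧ γ 0 = x ∧ γ 1 = y}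

/-- The generalized urban metric `d_{S,a,b}`. -/
def urbanDist {n : ℕ} (S : Set (EuclideanSpace ℝ (Fin n))) (a : ℝ≥0∞)
    (b : EuclideanSpace ℝ (Fin n) → ℝ≥0) (x y : EuclideanSpace ℝ (Fin n)) : ℝ≥0∞ :=
  ⨅ γ ∈ connectingPaths x y,
    (∫⁻ z in range γ ∩ S, (b z : ℝ≥0∞) ∂(μH[1])) + a * μH[1] (range γ \ S)

/-- The norm of the derivative of a path at time `t`. The path is extended to the line by its
endpoint values, which does not affect the derivative at interior times. -/
def speed {n : ℕ} (γ : I → EuclideanSpace ℝ (Fin n)) (t : ℝ) : ℝ≥0∞ :=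
  ‖deriv (IccExtend (zero_le_one' ℝ) γ) t‖ₑ

/-- The arc length `∫₀¹ |γ'(t)| dt`. -/
def arcLength {n : ℕ} (γ : I → EuclideanSpace ℝ (Fin n)) : ℝ≥0∞ :=
  ∫⁻ t in Icc (0 : ℝ) 1, speed γ t

/-- The travel cost `L(γ) = ∫₀¹ b(γ(t)) |γ'(t)| dt`, with multiplicity. -/
def pathCost {n : ℕ} (S : Set (EuclideanSpace ℝ (Fin n))) (a : ℝ≥0∞)
    (b : EuclideanSpace ℝ (Fin n) → ℝ≥0) (γ : I → EuclideanSpace ℝ (Fin n)) : ℝ≥0∞ :=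
  ∫⁻ t in Icc (0 : ℝ) 1, friction S a b (IccExtend (zero_le_one' ℝ) γ t) * speed γ t

/-- The constant `C_l`: `ℋ¹(S₁) + l` if `a = ∞`, and `ℋ¹(S_{a/2}) + (2/a) l` if `a < ∞`. -/
def lengthBound {n : ℕ} (S : Set (EuclideanSpace ℝ (Fin n))) (a : ℝ≥0∞)
    (b : EuclideanSpace ℝ (Fin n) → ℝ≥0) (l : ℝ≥0∞) : ℝ≥0∞ :=
  if a = ⊤ then μH[1] (sublevel S b 1) + l else μH[1] (sublevel S b (a / 2)) + 2 / a * l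

/-- The set `Γ` of Lipschitz paths `[0,1] → [-1,1]ⁿ`. -/
structure LipPath (n : ℕ) where
  toFun : I → EuclideanSpace ℝ (Fin n)
  lipschitz : ∃ K : ℝ≥0, LipschitzWith K toFun
  mem_cube : ∀ t, toFun t ∈ cube n

/-- `d_Θ(γ₁, γ₂)`: the infimum of `sup_t |γ₁(t) - γ₂(φ(t))|` over all increasing bijections `φ` of
`[0,1]`. -/
def dTheta {n : ℕ} (γ₁ γ₂ : LipPath n) : ℝ :=
  ⨅ φ : I ≃o I, ⨆ t : I, dist (γ₁.toFun t) (γ₂.toFun (φ t))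

theorem LipPath.continuous {n : ℕ} (γ : LipPath n) : Continuous γ.toFun :=
  γ.lipschitz.elim fun _ hK => hK.continuous

theorem bddAbove_dist {n : ℕ} (γ₁ γ₂ : LipPath n) (φ : I ≃o I) :
    BddAbove (range fun t : I => dist (γ₁.toFun t) (γ₂.toFun (φ t))) :=
  (isCompact_range
    (γ₁.continuous.dist (γ₂.continuous.comp φ.continuous))).bddAbove

theorem iSup_dist_nonneg {n : ℕ} (γ₁ γ₂ : LipPath n) (φ : I ≃o I) :
    0 ≤ ⨆ t : I, dist (γ₁.toFun t) (γ₂.toFun (φ t)) :=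
  Real.iSup_nonneg fun _ => dist_nonneg

theorem dTheta_le {n : ℕ} (γ₁ γ₂ : LipPath n) (φ : I ≃o I) :
    dTheta γ₁ γ₂ ≤ ⨆ t : I, dist (γ₁.toFun t) (γ₂.toFun (φ t)) :=
  ciInf_le ⟨0, by rintro _ ⟨ψ, rfl⟩; exact iSup_dist_nonneg γ₁ γ₂ ψ⟩ φ

theorem dTheta_self {n : ℕ} (γ : LipPath n) : dTheta γ γ = 0 := by
  apply le_antisymm
  · refine (dTheta_le γ γ (OrderIso.refl I)).trans ?_
    simp
  · exact Real.iInf_nonneg fun φ => iSup_dist_nonneg γ γ φ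

theorem dTheta_comm_le {n : ℕ} (γ₁ γ₂ : LipPath n) : dTheta γ₁ γ₂ ≤ dTheta γ₂ γ₁ := by
  refine le_ciInf fun φ => (dTheta_le γ₁ γ₂ φ.symm).trans (ciSup_le fun t => ?_)
  have h := le_ciSup (bddAbove_dist γ₂ γ₁ φ) (φ.symm t)
  simpa [dist_comm] using h

theorem dTheta_triangle {n : ℕ} (γ₁ γ₂ γ₃ : LipPath n) :
    dTheta γ₁ γ₃ ≤ dTheta γ₁ γ₂ + dTheta γ₂ γ₃ := by
  refine le_ciInf_add_ciInf fun φ ψ => ?_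
  refine (dTheta_le γ₁ γ₃ (φ.trans ψ)).trans (ciSup_le fun t => ?_)
  exact (dist_triangle _ (γ₂.toFun (φ t)) _).trans
    (add_le_add (le_ciSup (bddAbove_dist γ₁ γ₂ φ) t) (le_ciSup (bddAbove_dist γ₂ γ₃ ψ) (φ t)))

instance (n : ℕ) : PseudoMetricSpace (LipPath n) where
  dist := dTheta
  dist_self := dTheta_self
  dist_comm γ₁ γ₂ := le_antisymm (dTheta_comm_le γ₁ γ₂) (dTheta_comm_le γ₂ γ₁)
  dist_triangle := dTheta_triangle

/-- The metric space `Θ`: the quotient of `Γ` by the relation `d_Θ(γ₁, γ₂) = 0`, with the metric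
induced by `d_Θ`. -/
abbrev Theta (n : ℕ) : Type := SeparationQuotient (LipPath n)

/-- The class `[γ]` of a path. -/
def pathClass {n : ℕ} (γ : LipPath n) : Theta n := SeparationQuotient.mk γ

theorem pathClass_eq_iff {n : ℕ} (γ₁ γ₂ : LipPath n) :
    pathClass γ₁ = pathClass γ₂ ↔ dTheta γ₁ γ₂ = 0 :=
  SeparationQuotient.mk_eq_mk.trans Metric.inseparable_iff

theorem dist_pathClass {n : ℕ} (γ₁ γ₂ : LipPath n) :
    dist (pathClass γ₁) (pathClass γ₂) = dTheta γ₁ γ₂ := rfl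

/-- `Θ` carries its Borel `σ`-algebra. -/
instance (n : ℕ) : MeasurableSpace (Theta n) := borel (Theta n)

instance (n : ℕ) : BorelSpace (Theta n) := ⟨rfl⟩

end UrbanMetric

end

/-! The direct method gives an optimal path for each pair of end points; a measurable selection then
makes the choice.

The image cost in `urbanDist` never exceeds the cost with multiplicity (`setLIntegral_image_le`).
Conversely, a path can be projected to the cube and replaced by an injective or constant path inside
its image (`exists_injective_lipschitz`), for which the area formula makes both costs equal. A
Chebyshev estimate bounds its length: off the sublevel set of `midLevel a`, which has finite
measure, the friction exceeds that level. At constant speed such paths share a Lipschitz constant,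
so Arzelà–Ascoli applies.

The cost is lower semicontinuous under uniform convergence even though the extended friction need
not be. By the layer cake formula it suffices to treat the length spent outside T = {friction ≤ r}
with ℋ¹(T) < ∞. A chord of the limit is at most the lower limit of the approximants' lengths outside
T, plus ℋ¹ of T on the limit arc: finiteness of ℋ¹(T) lets a neighbourhood of the arc shrink to it.
Summing over partitions and cancelling the limit's length inside T gives the claim.

For the selection, a compact metric space of paths is a continuous image of the Cantor set, a subset
of ℝ, and the least admissible parameter depends measurably on the end points. Finally, paths at
`dTheta`-distance zero have a common monotone reparametrization, so the conclusions hold for every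
representative. -/

noncomputable section

namespace UrbanMetric

open Filter Topology

/-! ### Arc length, variation and Hausdorff measure of Lipschitz curves. -/

section Calculus

variable {E : Type*} [NormedAddCommGroup E] [NormedSpace ℝ E]

theorem norm_deriv_le_of_dist_le {F : Type*} [NormedAddCommGroup F] [NormedSpace ℝ F]
    {f : ℝ → F} {g : ℝ → E} {f' : F} {g' : E} {t : ℝ} (hf : HasDerivAt f f' t)
    (hg : HasDerivAt g g' t) (h : ∀ s, dist (f s) (f t) ≤ dist (g s) (g t)) : ‖f'‖ ≤ ‖g'‖ := by
  refine le_of_tendsto_of_tendsto' (hasDerivAt_iff_tendsto_slope.1 hf).norm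
    (hasDerivAt_iff_tendsto_slope.1 hg).norm fun s => ?_
  simp only [slope_def_module, norm_smul]
  gcongr
  simpa [dist_eq_norm] using h s

/-- The measure `|g'| dt`. -/
def lengthMeasure (g : ℝ → E) : Measure ℝ :=
  volume.withDensity fun t => ‖deriv g t‖ₑ

/-- The arc length of `g` from `0` to `t`, with sign. -/
def arcParam (g : ℝ → E) (t : ℝ) : ℝ := ∫ x in (0 : ℝ)..t, ‖deriv g x‖

theorem lengthMeasure_absolutelyContinuous (g : ℝ → E) : lengthMeasure g ≪ volume :=
  withDensity_absolutelyContinuous _ _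

instance (g : ℝ → E) : NullSingletonClass (lengthMeasure g) :=
  ⟨fun x => lengthMeasure_absolutelyContinuous g (measure_singleton x)⟩

variable [FiniteDimensional ℝ E] [MeasurableSpace E] [BorelSpace E]

theorem measurable_enorm_deriv (g : ℝ → E) : Measurable fun t => ‖deriv g t‖ₑ := by
  have := FiniteDimensional.complete ℝ E
  exact (measurable_deriv g).enorm

theorem measurable_norm_deriv (g : ℝ → E) : Measurable fun t => ‖deriv g t‖ := by
  have := FiniteDimensional.complete ℝ E
  exact (measurable_deriv g).norm

theorem intervalIntegrable_norm_deriv {g : ℝ → E} {K : ℝ≥0} (hg : LipschitzWith K g) (u v : ℝ) :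
    IntervalIntegrable (fun t => ‖deriv g t‖) volume u v := by
  refine (intervalIntegrable_const (c := (K : ℝ))).mono_fun
    (measurable_norm_deriv g).aestronglyMeasurable (ae_of_all _ fun t => ?_)
  simpa using norm_deriv_le_of_lipschitz hg

theorem arcParam_sub {g : ℝ → E} {K : ℝ≥0} (hg : LipschitzWith K g) (u v : ℝ) :
    arcParam g v - arcParam g u = ∫ x in u..v, ‖deriv g x‖ :=
  intervalIntegral.integral_interval_sub_left (intervalIntegrable_norm_deriv hg _ _)
    (intervalIntegrable_norm_deriv hg _ _)

theorem arcParam_monotone {g : ℝ → E} {K : ℝ≥0} (hg : LipschitzWith K g) :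
    Monotone (arcParam g) := fun u v huv => by
  rw [← sub_nonneg, arcParam_sub hg]
  exact intervalIntegral.integral_nonneg huv fun _ _ => norm_nonneg _

theorem lengthMeasure_Icc {g : ℝ → E} {K : ℝ≥0} (hg : LipschitzWith K g) {u v : ℝ} (huv : u ≤ v) :
    lengthMeasure g (Icc u v) = ENNReal.ofReal (arcParam g v - arcParam g u) := by
  rw [arcParam_sub hg, intervalIntegral.integral_of_le huv, lengthMeasure,
    withDensity_apply _ measurableSet_Icc, ← Measure.restrict_congr_set Ioc_ae_eq_Icc,
    ofReal_integral_eq_lintegral_ofReal]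
  · simp [ofReal_norm]
  · exact (intervalIntegrable_iff_integrableOn_Ioc_of_le huv).1
      (intervalIntegrable_norm_deriv hg u v)
  · exact ae_of_all _ fun _ => norm_nonneg _

theorem lengthMeasure_Icc_ne_top {g : ℝ → E} {K : ℝ≥0} (hg : LipschitzWith K g) (u v : ℝ) :
    lengthMeasure g (Icc u v) ≠ ⊤ := by
  rcases le_total u v with h | h
  · rw [lengthMeasure_Icc hg h]; exact ENNReal.ofReal_ne_top
  · have : (Icc u v).Subsingleton := subsingleton_Icc_of_ge h
    rw [this.measure_zero]; simp

theorem arcParam_lipschitz {g : ℝ → E} {K : ℝ≥0} (hg : LipschitzWith K g) :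
    LipschitzWith K (arcParam g) := by
  refine LipschitzWith.of_dist_le_mul fun u v => ?_
  rw [dist_comm, Real.dist_eq, arcParam_sub hg, ← Real.norm_eq_abs, dist_comm, Real.dist_eq]
  refine intervalIntegral.norm_integral_le_of_norm_le_const fun t _ => ?_
  simpa using norm_deriv_le_of_lipschitz hg

/-- The distance to the fixed point `g u` is a real Lipschitz function, so it is the integral of its
derivative, which is at most `‖deriv g‖` almost everywhere. -/
theorem dist_le_arcParam_sub {g : ℝ → E} {K : ℝ≥0} (hg : LipschitzWith K g) {u v : ℝ}
    (huv : u ≤ v) : dist (g u) (g v) ≤ arcParam g v - arcParam g u := by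
  set f : ℝ → ℝ := fun t => dist (g t) (g u) with hf
  have hfL : LipschitzWith K f := by
    refine LipschitzWith.of_dist_le_mul fun s t => ?_
    exact (dist_dist_dist_le_left (g s) (g t) (g u)).trans (hg.dist_le_mul s t)
  have hfac := (hfL.lipschitzOnWith (s := uIcc u v)).absolutelyContinuousOnInterval
  have key := hfac.integral_deriv_eq_sub
  have h0 : f v - f u = dist (g u) (g v) := by simp [hf, dist_comm]
  rw [← h0, ← key, arcParam_sub hg]
  refine intervalIntegral.integral_mono_ae huv
    hfac.intervalIntegrable_deriv
    (intervalIntegrable_norm_deriv hg u v) ?_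
  filter_upwards [hg.ae_differentiableAt_real, hfL.ae_differentiableAt_real] with t h1 h2
  refine (le_abs_self _).trans (norm_deriv_le_of_dist_le h2.hasDerivAt h1.hasDerivAt fun s => ?_)
  exact dist_dist_dist_le_left _ _ _

theorem dist_le_abs_arcParam_sub {g : ℝ → E} {K : ℝ≥0} (hg : LipschitzWith K g) (u v : ℝ) :
    dist (g u) (g v) ≤ dist (arcParam g u) (arcParam g v) := by
  rcases le_total u v with h | h
  · rw [dist_comm (arcParam g u), Real.dist_eq]
    exact (dist_le_arcParam_sub hg h).trans (le_abs_self _)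
  · rw [dist_comm (g u), Real.dist_eq]
    exact (dist_le_arcParam_sub hg h).trans (le_abs_self _)

theorem hasDerivAt_arcParam_ae {g : ℝ → E} {K : ℝ≥0} (hg : LipschitzWith K g) :
    ∀ᵐ t, HasDerivAt (arcParam g) ‖deriv g t‖ t := by
  have hloc : LocallyIntegrable (fun t => ‖deriv g t‖) volume :=
    (locallyIntegrable_const (K : ℝ)).mono (measurable_norm_deriv g).aestronglyMeasurable
      (ae_of_all _ fun t => by simpa using norm_deriv_le_of_lipschitz hg)
  filter_upwards [LocallyIntegrable.ae_hasDerivAt_integral hloc] with t ht using ht 0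

theorem eVariationOn_Icc_eq_lengthMeasure {g : ℝ → E} {K : ℝ≥0} (hg : LipschitzWith K g) {u v : ℝ}
    (huv : u ≤ v) : eVariationOn g (Icc u v) = lengthMeasure g (Icc u v) := by
  apply le_antisymm
  · have h := ((arcParam_monotone hg).monotoneOn (Icc u v)).eVariationOn_eq (left_mem_Icc.2 huv)
      (right_mem_Icc.2 huv)
    rw [inter_self] at h
    rw [lengthMeasure_Icc hg huv, ← h]
    refine iSup_mono fun p => Finset.sum_le_sum fun i _ => ?_
    rw [edist_dist, edist_dist]
    exact ENNReal.ofReal_le_ofReal (dist_le_abs_arcParam_sub hg _ _)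
  -- The variation function `W` is monotone and dominates the chords of `g`. Hence `‖g'‖ ≤ W'`
  -- almost everywhere, and a monotone function increases by at least the integral of its
  -- derivative.
  · have hlb : LocallyBoundedVariationOn g univ := hg.locallyBoundedVariationOn univ
    set W := variationOnFromTo g univ u with hW
    have hmono : Monotone W := monotoneOn_univ.1 (variationOnFromTo.monotoneOn hlb (mem_univ u))
    have hle : ∀ s t, dist (g s) (g t) ≤ dist (W s) (W t) := by
      have aux : ∀ s t, s ≤ t → dist (g s) (g t) ≤ dist (W s) (W t) := fun s t hst => by
        rw [dist_comm (W s), Real.dist_eq, hW,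
          variationOnFromTo.sub_right hlb (mem_univ _) (mem_univ _) (mem_univ _),
          variationOnFromTo.eq_of_le _ _ hst, abs_of_nonneg ENNReal.toReal_nonneg]
        refine (hlb s t (mem_univ _) (mem_univ _)).dist_le ?_ ?_ <;> simp [hst]
      intro s t
      rcases le_total s t with h | h
      · exact aux s t h
      · rw [dist_comm (g s), dist_comm (W s)]; exact aux t s h
    have hint := (hmono.monotoneOn (uIcc u v)).intervalIntegral_deriv_mem_uIcc
    have hWu : W u = 0 := variationOnFromTo.self _ _ _
    have hWv : W v = (eVariationOn g (Icc u v)).toReal := by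
      rw [hW, variationOnFromTo.eq_of_le _ _ huv, univ_inter]
    have hfin : eVariationOn g (Icc u v) ≠ ⊤ := by
      have := hlb u v (mem_univ _) (mem_univ _)
      rwa [univ_inter] at this
    rw [hWu, sub_zero, hWv, uIcc_of_le ENNReal.toReal_nonneg] at hint
    rw [lengthMeasure_Icc hg huv, arcParam_sub hg, ← ENNReal.ofReal_toReal hfin]
    refine ENNReal.ofReal_le_ofReal (le_trans ?_ hint.2)
    refine intervalIntegral.integral_mono_ae huv (intervalIntegrable_norm_deriv hg u v)
      (hmono.monotoneOn (uIcc u v)).intervalIntegrable_deriv ?_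
    filter_upwards [hg.ae_differentiableAt_real, hmono.ae_differentiableAt] with t h1 h2
    refine (norm_deriv_le_of_dist_le h1.hasDerivAt h2.hasDerivAt fun s => hle s t).trans ?_
    rw [Real.norm_eq_abs, abs_of_nonneg hmono.deriv_nonneg]

/-- Parametrized by arc length the curve is 1-Lipschitz, so only the measure of `V '' A` on the line
has to be estimated. There the change of variables inequality applies off a null set, and the
Lipschitz map `V` preserves null sets. -/
theorem hausdorffMeasure_image_le_lengthMeasure {g : ℝ → E} {K : ℝ≥0} (hg : LipschitzWith K g)
    {A : Set ℝ} (hA : MeasurableSet A) : μH[1] (g '' A) ≤ lengthMeasure g A := by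
  set V := arcParam g with hV
  have h1 : μH[1] (g '' A) ≤ volume (V '' A) := by
    -- The choice of preimage is harmless: times with equal arc parameter give the same point.
    set h : ℝ → E := fun r => g (Function.invFunOn V A r) with hh
    have hgh : ∀ t ∈ A, h (V t) = g t := fun t ht => by
      have := Function.invFunOn_eq (f := V) (s := A) (b := V t) ⟨t, ht, rfl⟩
      have h2 := dist_le_abs_arcParam_sub hg (Function.invFunOn V A (V t)) t
      rw [← hV, this, dist_self] at h2
      exact dist_le_zero.1 h2
    have hlip : LipschitzOnWith 1 h (V '' A) := by
      refine LipschitzOnWith.of_dist_le_mul ?_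
      rintro _ ⟨s, hs, rfl⟩ _ ⟨t, ht, rfl⟩
      rw [hgh s hs, hgh t ht]
      simpa using dist_le_abs_arcParam_sub hg s t
    have himg : g '' A = h '' (V '' A) := by
      rw [image_image]
      exact image_congr fun t ht => (hgh t ht).symm
    rw [himg, ← hausdorffMeasure_real]
    simpa using hlip.hausdorffMeasure_image_le zero_le_one
  refine h1.trans ?_
  obtain ⟨N, hNsub, hNm, hN0⟩ := exists_measurable_superset_of_null (hasDerivAt_arcParam_ae hg)
  have hVN : volume (V '' N) = 0 := by
    have := (arcParam_lipschitz hg).hausdorffMeasure_image_le zero_le_one N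
    rw [hausdorffMeasure_real, hN0] at this
    simpa using this
  have h2 : volume (V '' (A \ N)) ≤ ∫⁻ t in A \ N, ‖deriv g t‖ₑ := by
    refine (addHaar_image_le_lintegral_abs_det_fderiv volume (hA.diff hNm)
      (f' := fun t => ContinuousLinearMap.toSpanSingleton ℝ (‖deriv g t‖)) fun t ht => ?_).trans ?_
    · have : HasDerivAt V ‖deriv g t‖ t := by
        by_contra hc
        exact ht.2 (hNsub hc)
      exact this.hasDerivWithinAt.hasFDerivWithinAt
    · refine lintegral_mono fun t => ?_
      simp
  calc volume (V '' A) ≤ volume (V '' (A \ N) ∪ V '' N) := by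
        rw [← image_union]
        exact measure_mono (image_mono (by simp))
    _ ≤ volume (V '' (A \ N)) + volume (V '' N) := measure_union_le _ _
    _ ≤ ∫⁻ t in A \ N, ‖deriv g t‖ₑ := by rw [hVN, add_zero]; exact h2
    _ ≤ lengthMeasure g A := by
        rw [lengthMeasure, withDensity_apply _ hA]
        exact lintegral_mono_set sdiff_subset

-- The distance to `g u` is 1-Lipschitz and, by the intermediate value theorem, maps the arc onto an
-- interval at least as long as the chord.
omit [NormedSpace ℝ E] [FiniteDimensional ℝ E] in
theorem edist_le_hausdorffMeasure_image {g : ℝ → E} {u v : ℝ} (huv : u ≤ v)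
    (hg : ContinuousOn g (Icc u v)) : edist (g u) (g v) ≤ μH[1] (g '' Icc u v) := by
  set f : E → ℝ := fun z => dist z (g u)
  have hf : LipschitzWith 1 f := LipschitzWith.dist_left (g u)
  have h1 : Icc 0 (dist (g v) (g u)) ⊆ f '' (g '' Icc u v) := by
    have := intermediate_value_Icc huv (hf.continuous.comp_continuousOn hg)
    simpa [f, image_image] using this
  calc edist (g u) (g v) = volume (Icc 0 (dist (g v) (g u))) := by
        rw [Real.volume_Icc, sub_zero, edist_comm, edist_dist]
    _ ≤ volume (f '' (g '' Icc u v)) := measure_mono h1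
    _ ≤ μH[1] (g '' Icc u v) := by
        rw [← hausdorffMeasure_real]
        simpa using hf.hausdorffMeasure_image_le zero_le_one (g '' Icc u v)

omit [NormedSpace ℝ E] [FiniteDimensional ℝ E] in
theorem edist_le_hausdorffMeasure_image_Ioc {g : ℝ → E} {u v : ℝ} (huv : u ≤ v)
    (hg : ContinuousOn g (Icc u v)) : edist (g u) (g v) ≤ μH[1] (g '' Ioc u v) := by
  have := Measure.nullSingletonClass_hausdorff E (d := 1) one_pos
  refine (edist_le_hausdorffMeasure_image huv hg).trans ?_
  rw [← Ioc_insert_left huv, image_insert_eq, insert_eq]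
  refine (measure_union_le _ _).trans ?_
  simp

/-- The travel cost of a path dominates the cost of its image. -/
theorem setLIntegral_image_le {g : ℝ → E} {K : ℝ≥0} (hg : LipschitzWith K g) {J : Set ℝ}
    (hJ : MeasurableSet J) {f : E → ℝ≥0∞} (hf : Measurable f) :
    ∫⁻ z in g '' J, f z ∂μH[1] ≤ ∫⁻ t in J, f (g t) ∂(lengthMeasure g) := by
  rw [← lintegral_map hf hg.continuous.measurable]
  refine lintegral_mono' (Measure.le_iff.2 fun B hB => ?_) le_rfl
  rw [Measure.restrict_apply hB, Measure.map_apply hg.continuous.measurable hB,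
    Measure.restrict_apply (hg.continuous.measurable hB), inter_comm, ← image_inter_preimage,
    inter_comm]
  exact hausdorffMeasure_image_le_lengthMeasure hg ((hg.continuous.measurable hB).inter hJ)

/-- The area formula for an injective path. -/
theorem setLIntegral_image_eq_of_injOn {g : ℝ → E} {K : ℝ≥0} (hg : LipschitzWith K g) {u v : ℝ}
    (huv : u ≤ v) (hinj : InjOn g (Icc u v)) {f : E → ℝ≥0∞} (hf : Measurable f) :
    ∫⁻ t in Icc u v, f (g t) ∂(lengthMeasure g) = ∫⁻ z in g '' Icc u v, f z ∂μH[1] := by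
  have hns := Measure.nullSingletonClass_hausdorff E (d := 1) one_pos
  have hmeas : ∀ s t, MeasurableSet (g '' Icc s t) := fun s t =>
    (isCompact_Icc.image hg.continuous).isClosed.measurableSet
  apply le_antisymm _ (setLIntegral_image_le hg measurableSet_Icc hf)
  -- Half-open pieces have disjoint images by injectivity, so the chords of a partition sum to at
  -- most the measure of the image.
  have htot : lengthMeasure g (Icc u v) ≤ μH[1] (g '' Icc u v) := by
    rw [← eVariationOn_Icc_eq_lengthMeasure hg huv]
    refine iSup_le fun ⟨n, w, hw, hwm⟩ => ?_
    have hsub : ∀ i, Ioc (w i) (w (i + 1)) ⊆ Icc u v := fun i =>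
      Ioc_subset_Icc_self.trans (Icc_subset_Icc (hwm i).1 (hwm (i + 1)).2)
    calc ∑ i ∈ Finset.range n, edist (g (w (i + 1))) (g (w i))
        ≤ ∑ i ∈ Finset.range n, μH[1] (g '' Ioc (w i) (w (i + 1))) := by
          refine Finset.sum_le_sum fun i _ => ?_
          rw [edist_comm]
          exact edist_le_hausdorffMeasure_image_Ioc (hw i.le_succ) hg.continuous.continuousOn
      _ = μH[1] (⋃ i ∈ Finset.range n, g '' Ioc (w i) (w (i + 1))) := by
          refine (measure_biUnion_finset (fun i _ j _ hij => ?_) fun i _ => ?_).symm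
          · exact (hw.pairwise_disjoint_on_Ioc_succ hij).image hinj (hsub i) (hsub j)
          · have : g '' Ioc (w i) (w (i + 1)) = g '' Icc (w i) (w (i + 1)) \ {g (w i)} := by
              ext z
              constructor
              · rintro ⟨t, ht, rfl⟩
                refine ⟨⟨t, Ioc_subset_Icc_self ht, rfl⟩, fun h => ?_⟩
                exact ht.1.ne' (hinj (hsub i ht) (hwm i) h)
              · rintro ⟨⟨t, ht, rfl⟩, h⟩
                refine ⟨t, ⟨lt_of_le_of_ne ht.1 fun h' => h ?_, ht.2⟩, rfl⟩
                rw [h']; rfl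
            rw [this]
            exact (hmeas _ _).diff (measurableSet_singleton _)
      _ ≤ μH[1] (g '' Icc u v) :=
          measure_mono (iUnion₂_subset fun i _ => image_mono (hsub i))
  have hfin := lengthMeasure_Icc_ne_top hg u v
  rw [← lintegral_map hf hg.continuous.measurable]
  refine lintegral_mono' (Measure.le_iff.2 fun B hB => ?_) le_rfl
  have hB' := hg.continuous.measurable hB
  rw [Measure.restrict_apply hB, Measure.map_apply hg.continuous.measurable hB,
    Measure.restrict_apply hB', inter_comm B, ← image_inter_preimage, inter_comm]
  -- The total masses compare in one direction and the parts outside `B` in the other; subtracting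
  -- the finite length outside `B` compares the parts inside.
  have h1 := hausdorffMeasure_image_le_lengthMeasure hg
    (measurableSet_Icc.diff hB' : MeasurableSet (Icc u v \ g ⁻¹' B))
  have h2 : μH[1] (g '' Icc u v) ≤ μH[1] (g '' (Icc u v ∩ g ⁻¹' B)) +
      lengthMeasure g (Icc u v \ g ⁻¹' B) := by
    refine le_trans ?_ (add_le_add_right h1 _)
    refine le_trans (measure_mono ?_) (measure_union_le _ _)
    rw [← image_union, inter_union_sdiff]
  have h3 := measure_inter_add_sdiff (μ := lengthMeasure g) (Icc u v) hB'
  refine ENNReal.le_of_add_le_add_right (a := lengthMeasure g (Icc u v \ g ⁻¹' B)) ?_ ?_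
  · exact ne_top_of_le_ne_top hfin (measure_mono sdiff_subset)
  · rw [h3]; exact htot.trans h2

end Calculus

/-! ### Superadditivity of the lower limit and the layer cake formula. -/

theorem sum_liminf_le_liminf_sum {ι : Type*} (s : Finset ι) (a : ι → ℕ → ℝ≥0∞) :
    ∑ i ∈ s, liminf (a i) atTop ≤ liminf (fun k => ∑ i ∈ s, a i k) atTop := by
  simp only [liminf_eq_iSup_iInf_of_nat]
  rw [ENNReal.finsetSum_iSup_of_monotone]
  · exact iSup_mono fun n => le_iInf₂ fun k hk => Finset.sum_le_sum fun i _ => iInf₂_le k hk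
  · exact fun i m n hmn => le_iInf₂ fun k hk => iInf₂_le k (le_trans hmn hk)

theorem volume_ofReal_lt (x : ℝ≥0∞) :
    volume.restrict (Ioi 0) {r : ℝ | ENNReal.ofReal r < x} = x := by
  have hm : MeasurableSet {r : ℝ | ENNReal.ofReal r < x} :=
    measurableSet_lt ENNReal.measurable_ofReal measurable_const
  rw [Measure.restrict_apply hm]
  by_cases hx : x = ⊤
  · have : {r : ℝ | ENNReal.ofReal r < x} = univ := by ext r; simp [hx]
    rw [this, univ_inter, hx, Real.volume_Ioi]
  · have : {r : ℝ | ENNReal.ofReal r < x} ∩ Ioi 0 = Ioo 0 x.toReal := by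
      ext r
      simp only [mem_inter_iff, mem_ofPred_eq, mem_Ioi, mem_Ioo]
      rw [and_comm]
      refine and_congr_right fun hr => ?_
      rw [ENNReal.ofReal_lt_iff_lt_toReal hr.le hx]
    rw [this, Real.volume_Ioo, sub_zero, ENNReal.ofReal_toReal hx]

/-- The layer cake formula for functions with values in `[0,∞]`. -/
theorem lintegral_eq_lintegral_measure_lt {α : Type*} [MeasurableSpace α] (μ : Measure α)
    [SFinite μ] {f : α → ℝ≥0∞} (hf : Measurable f) :
    ∫⁻ x, f x ∂μ = ∫⁻ r in Ioi (0 : ℝ), μ {x | ENNReal.ofReal r < f x} := by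
  have hS : MeasurableSet {p : α × ℝ | ENNReal.ofReal p.2 < f p.1} :=
    measurableSet_lt (ENNReal.measurable_ofReal.comp measurable_snd) (hf.comp measurable_fst)
  have h1 : ∀ x, f x = ∫⁻ r in Ioi (0 : ℝ),
      {p : α × ℝ | ENNReal.ofReal p.2 < f p.1}.indicator 1 (x, r) := fun x => by
    conv_lhs => rw [← volume_ofReal_lt (f x)]
    rw [← lintegral_indicator_one (measurableSet_lt ENNReal.measurable_ofReal measurable_const)]
    rfl
  have h2 : ∀ r : ℝ, μ {x | ENNReal.ofReal r < f x} =
      ∫⁻ x, {p : α × ℝ | ENNReal.ofReal p.2 < f p.1}.indicator 1 (x, r) ∂μ := fun r => by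
    rw [← lintegral_indicator_one (measurableSet_lt measurable_const hf)]
    rfl
  simp_rw [h2]
  rw [lintegral_congr h1]
  exact lintegral_lintegral_swap (measurable_one.indicator hS).aemeasurable

/-! ### Lower semicontinuity of the travel cost. -/

section Semicontinuity

variable {E : Type*} [NormedAddCommGroup E] [NormedSpace ℝ E]
  [FiniteDimensional ℝ E] [MeasurableSpace E] [BorelSpace E]

/-- The approximating arc splits into its part outside `T`, controlled by length, and its part in
`T`, which eventually lies in a thin neighbourhood of the limit arc. Since `μH[1] T` is finite, the
measure of that neighbourhood within `T` tends to that of the arc. -/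
theorem edist_le_liminf_lengthMeasure_add {g : ℝ → E} {gs : ℕ → ℝ → E} (hg : Continuous g)
    (hgs : ∀ k, ∃ K : ℝ≥0, LipschitzWith K (gs k)) {u v : ℝ} (huv : u ≤ v)
    (hlim : TendstoUniformlyOn gs g atTop (Icc u v)) {T : Set E} (hT : MeasurableSet T)
    (hTfin : μH[1] T ≠ ⊤) :
    edist (g u) (g v) ≤
      liminf (fun k => lengthMeasure (gs k) (Icc u v ∩ gs k ⁻¹' Tᶜ)) atTop +
        μH[1] (T ∩ g '' Icc u v) := by
  set X := g '' Icc u v with hX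
  have hXc : IsClosed X := (isCompact_Icc.image hg).isClosed
  set μ : Measure E := μH[1].restrict T with hμ
  have hμfin : ∀ A, μ A ≠ ⊤ := fun A =>
    ne_top_of_le_ne_top hTfin ((measure_mono (subset_univ A)).trans (by simp [hμ]))
  have hcth : Tendsto (fun r => μ (Metric.cthickening r X)) (𝓝 0) (𝓝 (μ X)) := by
    have := tendsto_measure_cthickening (μ := μ) (s := X) ⟨1, one_pos, hμfin _⟩
    rwa [hXc.closure_eq] at this
  have hμX : μ X = μH[1] (T ∩ X) := by
    rw [hμ, Measure.restrict_apply hXc.measurableSet, inter_comm]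
  rw [← hμX]
  refine ENNReal.le_of_forall_pos_le_add fun ε hε _ => ?_
  have hlt : μ X < μ X + ε := ENNReal.lt_add_right (hμfin X) (by simpa using hε.ne')
  obtain ⟨δ, hδlt, hδ⟩ : ∃ δ, μ (Metric.cthickening δ X) < μ X + ε ∧ 0 < δ := by
    have h1 := (hcth.mono_left (nhdsWithin_le_nhds (s := Ioi 0))).eventually_lt_const hlt
    exact (h1.and self_mem_nhdsWithin).exists
  have hev : ∀ᶠ k in atTop, edist (gs k u) (gs k v) ≤
      lengthMeasure (gs k) (Icc u v ∩ gs k ⁻¹' Tᶜ) + (μ X + ε) := by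
    filter_upwards [Metric.tendstoUniformlyOn_iff.1 hlim δ hδ] with k hk
    obtain ⟨K, hK⟩ := hgs k
    have hpre := hK.continuous.measurable hT
    calc edist (gs k u) (gs k v) ≤ μH[1] (gs k '' Icc u v) :=
          edist_le_hausdorffMeasure_image huv hK.continuous.continuousOn
      _ ≤ μH[1] (gs k '' (Icc u v ∩ gs k ⁻¹' Tᶜ) ∪ Metric.cthickening δ X ∩ T) := by
          refine measure_mono ?_
          rintro _ ⟨t, ht, rfl⟩
          by_cases htT : gs k t ∈ T
          · refine Or.inr ⟨Metric.mem_cthickening_of_dist_le _ (g t) _ _ ⟨t, ht, rfl⟩ ?_, htT⟩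
            rw [dist_comm]
            exact (hk t ht).le
          · exact Or.inl ⟨t, ⟨ht, htT⟩, rfl⟩
      _ ≤ μH[1] (gs k '' (Icc u v ∩ gs k ⁻¹' Tᶜ)) + μH[1] (Metric.cthickening δ X ∩ T) :=
          measure_union_le _ _
      _ ≤ lengthMeasure (gs k) (Icc u v ∩ gs k ⁻¹' Tᶜ) + (μ X + ε) := by
          refine add_le_add (hausdorffMeasure_image_le_lengthMeasure hK
            (measurableSet_Icc.inter (hK.continuous.measurable hT.compl))) ?_
          rw [← Measure.restrict_apply Metric.isClosed_cthickening.measurableSet]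
          exact hδlt.le
  have hl : Tendsto (fun k => edist (gs k u) (gs k v)) atTop (𝓝 (edist (g u) (g v))) :=
    (hlim.tendsto_at (left_mem_Icc.2 huv)).edist (hlim.tendsto_at (right_mem_Icc.2 huv))
  rw [add_assoc, ← liminf_add_const]
  · rw [← hl.liminf_eq]
    exact liminf_le_liminf hev
  · isBoundedDefault
  · isBoundedDefault

/-- The length of a path outside a set of finite `ℋ¹`-measure is lower semicontinuous. -/
theorem lengthMeasure_preimage_compl_le_liminf {g : ℝ → E} {K : ℝ≥0} (hg : LipschitzWith K g)
    {gs : ℕ → ℝ → E} (hgs : ∀ k, ∃ K : ℝ≥0, LipschitzWith K (gs k)) {u v : ℝ} (huv : u ≤ v)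
    (hlim : TendstoUniformlyOn gs g atTop (Icc u v)) {T : Set E} (hT : MeasurableSet T)
    (hTfin : μH[1] T ≠ ⊤) :
    lengthMeasure g (Icc u v ∩ g ⁻¹' Tᶜ) ≤
      liminf (fun k => lengthMeasure (gs k) (Icc u v ∩ gs k ⁻¹' Tᶜ)) atTop := by
  have hpre := hg.continuous.measurable hT
  have key : lengthMeasure g (Icc u v) ≤
      liminf (fun k => lengthMeasure (gs k) (Icc u v ∩ gs k ⁻¹' Tᶜ)) atTop +
        lengthMeasure g (Icc u v ∩ g ⁻¹' T) := by
    rw [← eVariationOn_Icc_eq_lengthMeasure hg huv]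
    refine iSup_le fun ⟨n, w, hw, hwm⟩ => ?_
    have hsub : ∀ i, Icc (w i) (w (i + 1)) ⊆ Icc u v := fun i =>
      Icc_subset_Icc (hwm i).1 (hwm (i + 1)).2
    -- Adjacent intervals share only end points, which the atomless length measure ignores.
    have hsum : ∀ (h : ℝ → E) (A : Set ℝ), MeasurableSet A →
        ∑ i ∈ Finset.range n, lengthMeasure h (Icc (w i) (w (i + 1)) ∩ A) ≤
          lengthMeasure h (Icc u v ∩ A) := fun h A hA => by
      have : ∀ i, lengthMeasure h (Icc (w i) (w (i + 1)) ∩ A) =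
          lengthMeasure h (Ioc (w i) (w (i + 1)) ∩ A) := fun i =>
        measure_congr (Ioc_ae_eq_Icc.symm.inter (ae_eq_refl _))
      simp_rw [this]
      rw [← measure_biUnion_finset]
      · exact measure_mono (iUnion₂_subset fun i _ =>
          inter_subset_inter_left _ (Ioc_subset_Icc_self.trans (hsub i)))
      · exact fun i _ j _ hij => (hw.pairwise_disjoint_on_Ioc_succ hij).mono
          inter_subset_left inter_subset_left
      · exact fun i _ => measurableSet_Ioc.inter hA
    calc ∑ i ∈ Finset.range n, edist (g (w (i + 1))) (g (w i))
        ≤ ∑ i ∈ Finset.range n,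
          (liminf (fun k => lengthMeasure (gs k) (Icc (w i) (w (i + 1)) ∩ gs k ⁻¹' Tᶜ)) atTop +
            lengthMeasure g (Icc (w i) (w (i + 1)) ∩ g ⁻¹' T)) := by
          refine Finset.sum_le_sum fun i _ => ?_
          rw [edist_comm]
          refine (edist_le_liminf_lengthMeasure_add hg.continuous hgs (hw i.le_succ)
            (hlim.mono (hsub i)) hT hTfin).trans (add_le_add_right ?_ _)
          rw [inter_comm, ← image_inter_preimage]
          exact hausdorffMeasure_image_le_lengthMeasure hg (measurableSet_Icc.inter hpre)
      _ ≤ _ := by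
          rw [Finset.sum_add_distrib]
          refine add_le_add ((sum_liminf_le_liminf_sum _ _).trans
            (liminf_le_liminf (Eventually.of_forall fun k => ?_))) (hsum g _ hpre)
          obtain ⟨K, hK⟩ := hgs k
          exact hsum (gs k) _ (hK.continuous.measurable hT.compl)
  -- The full length of `g` splits along `T`; its part inside `T` is finite and cancels.
  have hfin := lengthMeasure_Icc_ne_top hg u v
  rw [← measure_inter_add_sdiff (μ := lengthMeasure g) (Icc u v) hpre, add_comm,
    sdiff_eq, ← preimage_compl] at key
  exact ENNReal.le_of_add_le_add_right
    (ne_top_of_le_ne_top hfin (measure_mono inter_subset_left)) key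

/-- Lower semicontinuity of the travel cost under uniform convergence. -/
theorem setLIntegral_lengthMeasure_le_liminf {g : ℝ → E} {K : ℝ≥0} (hg : LipschitzWith K g)
    {gs : ℕ → ℝ → E} (hgs : ∀ k, ∃ K : ℝ≥0, LipschitzWith K (gs k)) {u v : ℝ} (huv : u ≤ v)
    (hlim : TendstoUniformlyOn gs g atTop (Icc u v)) {f : E → ℝ≥0∞} (hf : Measurable f)
    {a : ℝ≥0∞} (hfa : ∀ z, f z ≤ a) (hfin : ∀ l < a, μH[1] {z | f z ≤ l} < ⊤) :
    ∫⁻ t in Icc u v, f (g t) ∂(lengthMeasure g) ≤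
      liminf (fun k => ∫⁻ t in Icc u v, f (gs k t) ∂(lengthMeasure (gs k))) atTop := by
  have hcake : ∀ h : ℝ → E, (∃ K : ℝ≥0, LipschitzWith K h) →
      ∫⁻ t in Icc u v, f (h t) ∂(lengthMeasure h) = ∫⁻ r in Ioi (0 : ℝ),
        lengthMeasure h (Icc u v ∩ h ⁻¹' {z | f z ≤ ENNReal.ofReal r}ᶜ) := by
    rintro h ⟨K, hK⟩
    have : IsFiniteMeasure ((lengthMeasure h).restrict (Icc u v)) :=
      ⟨by simpa using (lengthMeasure_Icc_ne_top hK u v).lt_top⟩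
    have hfh : Measurable fun t => f (h t) := hf.comp hK.continuous.measurable
    rw [lintegral_eq_lintegral_measure_lt _ hfh]
    refine lintegral_congr fun r => ?_
    rw [Measure.restrict_apply (measurableSet_lt measurable_const hfh), inter_comm]
    congr 2
    ext t
    simp
  rw [hcake g ⟨K, hg⟩, funext fun k => hcake (gs k) (hgs k)]
  -- Each level is semicontinuous, and Fatou's lemma passes this to the integral. Levels `r ≥ a`
  -- contribute nothing, as `f ≤ a`.
  refine le_trans (lintegral_mono fun r => ?_) (lintegral_liminf_le fun k => ?_)
  · by_cases hr : ENNReal.ofReal r < a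
    · exact lengthMeasure_preimage_compl_le_liminf hg hgs huv hlim
        (measurableSet_le hf measurable_const) (hfin _ hr).ne
    · have : {z | f z ≤ ENNReal.ofReal r} = univ :=
        eq_univ_of_forall fun z => (hfa z).trans (not_lt.1 hr)
      simp [this]
  · refine Antitone.measurable fun r s hrs => measure_mono ?_
    refine inter_subset_inter_right _ (preimage_mono (compl_subset_compl.2 fun z hz => ?_))
    exact le_trans hz (ENNReal.ofReal_le_ofReal hrs)

end Semicontinuity

/-- The extension of a path to the line by its endpoint values. -/
abbrev extend {E : Type*} (γ : I → E) : ℝ → E := IccExtend (zero_le_one' ℝ) γ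

theorem extend_coe {E : Type*} (γ : I → E) (t : I) : extend γ t = γ t :=
  IccExtend_val _ _ t

theorem extend_apply_of_mem {E : Type*} (γ : I → E) {t : ℝ} (ht : t ∈ Icc (0 : ℝ) 1) :
    extend γ t = γ ⟨t, ht⟩ :=
  IccExtend_of_mem _ _ ht

theorem extend_image_Icc {E : Type*} (γ : I → E) : extend γ '' Icc 0 1 = range γ := by
  ext z
  constructor
  · rintro ⟨t, ht, rfl⟩
    exact ⟨⟨t, ht⟩, (extend_apply_of_mem γ ht).symm⟩
  · rintro ⟨t, rfl⟩
    exact ⟨t, t.2, extend_coe γ t⟩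

theorem _root_.LipschitzWith.extend {E : Type*} [PseudoEMetricSpace E] {γ : I → E} {K : ℝ≥0}
    (hγ : LipschitzWith K γ) : LipschitzWith K (extend γ) := by
  have h := hγ.comp (LipschitzWith.projIcc (zero_le_one' ℝ))
  rwa [mul_one] at h

theorem orderIso_zero (φ : I ≃o I) : φ 0 = 0 := φ.map_bot

theorem orderIso_one (φ : I ≃o I) : φ 1 = 1 := φ.map_top

/-! ### Constant speed and common reparametrizations. -/

section Reparametrization

variable {E : Type*} [NormedAddCommGroup E] [NormedSpace ℝ E]

theorem arcParam_zero (g : ℝ → E) : arcParam g 0 = 0 := intervalIntegral.integral_same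

variable [FiniteDimensional ℝ E] [MeasurableSpace E] [BorelSpace E]

/-- A Lipschitz path factors through its reparametrization by constant speed. -/
theorem exists_constantSpeed {γ : I → E} {K : ℝ≥0} (hγ : LipschitzWith K γ) :
    ∃ (γ' : I → E) (s : I → I), LipschitzWith (arcParam (extend γ) 1).toNNReal γ' ∧
      Monotone s ∧ Continuous s ∧ Function.Surjective s ∧ (∀ t, γ' (s t) = γ t) ∧
      ∀ t : I, arcParam (extend γ) t = arcParam (extend γ) 1 * s t := by
  set V := arcParam (extend γ) with hV
  have hV0 : V 0 = 0 := arcParam_zero _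
  have hVm : Monotone V := arcParam_monotone hγ.extend
  have hVc : Continuous V := (arcParam_lipschitz hγ.extend).continuous
  have hV1 : 0 ≤ V 1 := hV0 ▸ hVm zero_le_one
  have hdist : ∀ s t : I, dist (γ s) (γ t) ≤ dist (V s) (V t) := fun s t => by
    simpa only [extend_coe] using dist_le_abs_arcParam_sub hγ.extend s t
  -- A path of length zero is constant and is kept; otherwise `s` is the arc parameter divided by
  -- the length.
  rcases hV1.eq_or_lt with h0 | hpos
  · have hVz : ∀ t : I, V t = 0 := fun t =>
      le_antisymm (h0 ▸ hVm t.2.2) (hV0 ▸ hVm t.2.1)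
    refine ⟨γ, id, LipschitzWith.of_dist_le_mul fun s t => ?_, monotone_id, continuous_id,
      Function.surjective_id, fun _ => rfl, fun t => by rw [hVz t, ← h0, zero_mul]⟩
    refine (hdist s t).trans ?_
    rw [hVz, hVz, dist_self]
    positivity
  · set s : I → I := fun t => ⟨V t / V 1, div_nonneg (hV0 ▸ hVm t.2.1) hV1,
      (div_le_one hpos).2 (hVm t.2.2)⟩ with hs
    have hVs : ∀ t : I, V t = V 1 * s t := fun t => by
      simp only [hs]; field_simp
    have hsurj : Function.Surjective s := fun r => by
      have hr : V 1 * r ∈ Icc (V 0) (V 1) :=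
        ⟨by rw [hV0]; exact mul_nonneg hV1 r.2.1, mul_le_of_le_one_right hV1 r.2.2⟩
      obtain ⟨t, ht, hVt⟩ := intermediate_value_Icc zero_le_one hVc.continuousOn hr
      refine ⟨⟨t, ht⟩, Subtype.ext ?_⟩
      simp only [hs, hVt]
      field_simp
    have hsc : Continuous s :=
      ((hVc.comp continuous_subtype_val).div_const _).subtype_mk _
    have hfac : ∀ t, γ (Function.surjInv hsurj (s t)) = γ t := fun t => by
      refine dist_le_zero.1 ((hdist _ _).trans ?_)
      rw [hVs, Function.surjInv_eq hsurj, ← hVs, dist_self]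
    refine ⟨fun r => γ (Function.surjInv hsurj r), s, LipschitzWith.of_dist_le_mul fun r r' => ?_,
      fun t t' h => ?_, hsc, hsurj, hfac, hVs⟩
    · refine (hdist _ _).trans ?_
      rw [hVs, hVs, Function.surjInv_eq hsurj, Function.surjInv_eq hsurj, Real.dist_eq, ← mul_sub,
        abs_mul, abs_of_nonneg hV1, Real.coe_toNNReal _ hV1]
      rfl
    · exact Subtype.mk_le_mk.2 (div_le_div_of_nonneg_right (hVm h) hV1)

/-- The length measure is transported by monotone reparametrizations. -/
theorem map_lengthMeasure_of_comp {γ γ' : I → E} {K K' : ℝ≥0} (hγ : LipschitzWith K γ)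
    (hγ' : LipschitzWith K' γ') {s : I → I} (hs : Monotone s) (hsc : Continuous s)
    (hsurj : Function.Surjective s) (h : ∀ t, γ' (s t) = γ t) :
    ((lengthMeasure (extend γ)).restrict (Icc 0 1)).map (extend fun t => (s t : ℝ)) =
      (lengthMeasure (extend γ')).restrict (Icc 0 1) := by
  set S : ℝ → ℝ := extend fun t => (s t : ℝ) with hS
  have hSmono : Monotone S := fun x y hxy => hs (monotone_projIcc _ hxy)
  have hScont : Continuous S := (continuous_subtype_val.comp hsc).Icc_extend'
  have hcomp : extend γ = extend γ' ∘ S := by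
    ext t
    simp only [Function.comp_apply, hS, IccExtend, projIcc_val, h]
  have hmem : ∀ t, S t ∈ Icc (0 : ℝ) 1 := fun t => (s _).2
  have hSsurj : ∀ r ∈ Icc (0 : ℝ) 1, ∃ t ∈ Icc (0 : ℝ) 1, S t = r := fun r hr => by
    obtain ⟨t, ht⟩ := hsurj ⟨r, hr⟩
    refine ⟨t, t.2, ?_⟩
    simp [hS, ht]
  have : IsFiniteMeasure ((lengthMeasure (extend γ)).restrict (Icc 0 1)) :=
    ⟨by simpa using (lengthMeasure_Icc_ne_top hγ.extend 0 1).lt_top⟩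
  -- The preimage of an initial interval is an initial interval ending at its last time, so equality
  -- of the measures reduces to invariance of variation under monotone reparametrization.
  refine Measure.ext_of_Iic _ _ fun r => ?_
  rw [Measure.map_apply hScont.measurable measurableSet_Iic,
    Measure.restrict_apply (hScont.measurable measurableSet_Iic),
    Measure.restrict_apply measurableSet_Iic]
  rcases lt_or_ge r 0 with hr | hr
  · have h1 : S ⁻¹' Iic r ∩ Icc 0 1 = ∅ :=
      eq_empty_of_forall_notMem fun t ht => absurd (ht.1.trans_lt hr) (not_lt.2 (hmem t).1)
    have h2 : Iic r ∩ Icc 0 1 = ∅ :=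
      eq_empty_of_forall_notMem fun t ht => absurd (lt_of_le_of_lt ht.1 hr) (not_lt.2 ht.2.1)
    rw [h1, h2, measure_empty, measure_empty]
  · have hcpt : IsCompact (S ⁻¹' Iic r ∩ Icc 0 1) :=
      isCompact_Icc.inter_left (isClosed_Iic.preimage hScont)
    obtain ⟨t₀, ht₀, hSt₀⟩ := hSsurj 0 (left_mem_Icc.2 zero_le_one)
    obtain ⟨t, ht, htmax⟩ := hcpt.exists_isGreatest
      ⟨t₀, show S t₀ ≤ r by rw [hSt₀]; exact hr, ht₀⟩
    have h1 : S ⁻¹' Iic r ∩ Icc 0 1 = Icc 0 t := by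
      ext x
      exact ⟨fun hx => ⟨hx.2.1, htmax hx⟩,
        fun hx => ⟨(hSmono hx.2).trans ht.1, hx.1, hx.2.trans ht.2.2⟩⟩
    have h2 : Iic r ∩ Icc 0 1 = Icc 0 (min r 1) := by
      ext x
      simp only [mem_inter_iff, mem_Iic, mem_Icc, le_min_iff]
      tauto
    have h3 : S '' Icc 0 t = Icc 0 (min r 1) := by
      rw [← h1, ← h2]
      ext x
      constructor
      · rintro ⟨y, hy, rfl⟩
        exact ⟨hy.1, hmem y⟩
      · rintro ⟨hx, hx'⟩
        obtain ⟨y, hy, rfl⟩ := hSsurj x hx'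
        exact ⟨y, ⟨hx, hy⟩, rfl⟩
    rw [h1, h2, ← eVariationOn_Icc_eq_lengthMeasure hγ.extend ht.2.1,
      ← eVariationOn_Icc_eq_lengthMeasure hγ'.extend (le_min hr zero_le_one), hcomp,
      eVariationOn.comp_eq_of_monotoneOn _ _ (hSmono.monotoneOn _), h3]

theorem setLIntegral_lengthMeasure_of_comp {γ γ' : I → E} {K K' : ℝ≥0} (hγ : LipschitzWith K γ)
    (hγ' : LipschitzWith K' γ') {s : I → I} (hs : Monotone s) (hsc : Continuous s)
    (hsurj : Function.Surjective s) (h : ∀ t, γ' (s t) = γ t) {f : E → ℝ≥0∞}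
    (hf : Measurable f) :
    ∫⁻ t in Icc 0 1, f (extend γ t) ∂(lengthMeasure (extend γ)) =
      ∫⁻ t in Icc 0 1, f (extend γ' t) ∂(lengthMeasure (extend γ')) := by
  have hScont : Continuous (extend fun t => (s t : ℝ)) :=
    (continuous_subtype_val.comp hsc).Icc_extend'
  have hfm : Measurable fun t => f (extend γ' t) := hf.comp hγ'.extend.continuous.measurable
  rw [← map_lengthMeasure_of_comp hγ hγ' hs hsc hsurj h, lintegral_map hfm hScont.measurable]
  refine lintegral_congr fun t => ?_
  simp only [IccExtend, Function.comp_apply, projIcc_val, h]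

/-- Variation is lower semicontinuous under pointwise convergence, and composing with a monotone map
cannot raise it above the variation over the enclosing interval. -/
theorem eventually_lt_arcParam_sub {g₁ g₂ : ℝ → E} {K₁ K₂ : ℝ≥0} (h₁ : LipschitzWith K₁ g₁)
    (h₂ : LipschitzWith K₂ g₂) {Φ : ℕ → ℝ → ℝ} (hΦ : ∀ k, Monotone (Φ k)) {u v : ℝ} (huv : u ≤ v)
    (hlim : ∀ t ∈ Icc u v, Tendsto (fun k => g₂ (Φ k t)) atTop (𝓝 (g₁ t))) {c : ℝ}
    (hc : c < arcParam g₁ v - arcParam g₁ u) :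
    ∀ᶠ k in atTop, c < arcParam g₂ (Φ k v) - arcParam g₂ (Φ k u) := by
  rcases lt_or_ge c 0 with hc0 | hc0
  · exact Eventually.of_forall fun k =>
      hc0.trans_le (sub_nonneg.2 (arcParam_monotone h₂ (hΦ k huv)))
  have hlt : ENNReal.ofReal c < eVariationOn g₁ (Icc u v) := by
    rw [eVariationOn_Icc_eq_lengthMeasure h₁ huv, lengthMeasure_Icc h₁ huv]
    exact (ENNReal.ofReal_lt_ofReal_iff_of_nonneg hc0).2 hc
  filter_upwards [eVariationOn.lowerSemicontinuous_aux (F := fun k => g₂ ∘ Φ k) hlim hlt] with k hk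
  have := hk.trans_le (eVariationOn.comp_le_of_monotoneOn g₂ (s := Icc (Φ k u) (Φ k v)) (Φ k)
    ((hΦ k).monotoneOn _) fun t ht => ⟨hΦ k ht.1, hΦ k ht.2⟩)
  rw [eVariationOn_Icc_eq_lengthMeasure h₂ (hΦ k huv), lengthMeasure_Icc h₂ (hΦ k huv)] at this
  exact (ENNReal.ofReal_lt_ofReal_iff_of_nonneg hc0).1 this

theorem arcParam_extend_one_le {γ₁ γ₂ : I → E} {K₁ K₂ : ℝ≥0} (h₁ : LipschitzWith K₁ γ₁)
    (h₂ : LipschitzWith K₂ γ₂) (φ : ℕ → I ≃o I)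
    (hlim : ∀ t, Tendsto (fun k => γ₂ (φ k t)) atTop (𝓝 (γ₁ t))) :
    arcParam (extend γ₁) 1 ≤ arcParam (extend γ₂) 1 := by
  refine le_of_forall_lt fun c hc => ?_
  obtain ⟨k, hk⟩ := (eventually_lt_arcParam_sub h₁.extend h₂.extend
    (Φ := fun k => extend fun t => (φ k t : ℝ))
    (fun k x y hxy => (φ k).monotone (monotone_projIcc _ hxy)) (zero_le_one' ℝ)
    (fun t ht => by simpa [extend_apply_of_mem _ ht] using hlim ⟨t, ht⟩)
    (c := c) (by rwa [arcParam_zero, sub_zero])).exists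
  refine hk.trans_le ?_
  have h0 : 0 ≤ arcParam (extend γ₂) (extend (fun t => (φ k t : ℝ)) 0) :=
    (arcParam_zero (extend γ₂)).ge.trans (arcParam_monotone h₂.extend (φ k _).2.1)
  have h1 := arcParam_monotone h₂.extend (show extend (fun t => (φ k t : ℝ)) 1 ≤ 1 from (φ k _).2.2)
  linarith

/-- Paths that agree up to reparametrizations and uniform limits of such have a common
reparametrization. -/
theorem exists_common_reparametrization {γ₁ γ₂ : I → E} {K₁ K₂ : ℝ≥0} (h₁ : LipschitzWith K₁ γ₁)
    (h₂ : LipschitzWith K₂ γ₂) (φ ψ : ℕ → I ≃o I)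
    (hφ : ∀ t, Tendsto (fun k => γ₂ (φ k t)) atTop (𝓝 (γ₁ t)))
    (hψ : ∀ t, Tendsto (fun k => γ₁ (ψ k t)) atTop (𝓝 (γ₂ t))) :
    ∃ (γ' : I → E) (s₁ s₂ : I → I) (K : ℝ≥0), LipschitzWith K γ' ∧
      (Monotone s₁ ∧ Continuous s₁ ∧ Function.Surjective s₁ ∧ ∀ t, γ' (s₁ t) = γ₁ t) ∧
      (Monotone s₂ ∧ Continuous s₂ ∧ Function.Surjective s₂ ∧ ∀ t, γ' (s₂ t) = γ₂ t) := by
  have hℓ : arcParam (extend γ₁) 1 = arcParam (extend γ₂) 1 :=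
    le_antisymm (arcParam_extend_one_le h₁ h₂ φ hφ) (arcParam_extend_one_le h₂ h₁ ψ hψ)
  obtain ⟨-, s₁, -, hm₁, hc₁, hs₁, -, hV₁⟩ := exists_constantSpeed h₁
  obtain ⟨γ', s₂, hγ', hm₂, hc₂, hs₂, hf₂, hV₂⟩ := exists_constantSpeed h₂
  refine ⟨γ', s₁, s₂, _, hγ', ⟨hm₁, hc₁, hs₁, fun t => ?_⟩, hm₂, hc₂, hs₂, hf₂⟩
  set Φ : ℕ → ℝ → ℝ := fun k => extend fun t => (φ k t : ℝ) with hΦ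
  have hΦm : ∀ k, Monotone (Φ k) := fun k x y hxy => (φ k).monotone (monotone_projIcc _ hxy)
  have hΦl : ∀ t ∈ Icc (0 : ℝ) 1,
      Tendsto (fun k => extend γ₂ (Φ k t)) atTop (𝓝 (extend γ₁ t)) := fun t ht => by
    simpa [hΦ, extend_apply_of_mem _ ht] using hφ ⟨t, ht⟩
  have hΦt : ∀ k, Φ k t = φ k t := fun k => extend_coe _ t
  have hΦ0 : ∀ k, Φ k 0 = 0 := fun k => by
    have := extend_coe (fun t => (φ k t : ℝ)) 0
    rwa [orderIso_zero] at this
  have hΦ1 : ∀ k, Φ k 1 = 1 := fun k => by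
    have := extend_coe (fun t => (φ k t : ℝ)) 1
    rwa [orderIso_one] at this
  -- Lower semicontinuity on `[0,t]` bounds the limit from below; on `[t,1]`, since the total
  -- lengths agree, it bounds it from above.
  have hVlim : Tendsto (fun k => arcParam (extend γ₂) (φ k t)) atTop
      (𝓝 (arcParam (extend γ₁) t)) := by
    refine tendsto_order.2 ⟨fun c hc => ?_, fun c hc => ?_⟩
    · have := eventually_lt_arcParam_sub h₁.extend h₂.extend hΦm t.2.1
        (fun x hx => hΦl x ⟨hx.1, hx.2.trans t.2.2⟩) (c := c) (by rwa [arcParam_zero, sub_zero])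
      simpa [hΦt, hΦ0, arcParam_zero] using this
    · have := eventually_lt_arcParam_sub h₁.extend h₂.extend hΦm t.2.2
        (fun x hx => hΦl x ⟨t.2.1.trans hx.1, hx.2⟩) (c := arcParam (extend γ₁) 1 - c)
        (by linarith)
      filter_upwards [this] with k hk
      rw [hΦt, hΦ1, hℓ] at hk
      linarith
  -- Along `φ k t` the path `γ₂` tends to `γ₁ t` by assumption, and to `γ' (s₁ t)` by convergence of
  -- the arc parameters.
  refine tendsto_nhds_unique ?_ (hφ t)
  rw [tendsto_iff_dist_tendsto_zero]
  have h0 : Tendsto (fun k => dist (arcParam (extend γ₁) t) (arcParam (extend γ₂) (φ k t))) atTop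
      (𝓝 0) := by
    simpa using (tendsto_const_nhds (x := arcParam (extend γ₁) t)).dist hVlim
  refine squeeze_zero (fun _ => dist_nonneg) (fun k => ?_) h0
  rw [← hf₂, dist_comm]
  refine (hγ'.dist_le_mul _ _).trans (le_of_eq ?_)
  have h1 : 0 ≤ arcParam (extend γ₂) 1 :=
    (arcParam_zero (extend γ₂)).ge.trans (arcParam_monotone h₂.extend zero_le_one)
  rw [hV₁, hV₂, hℓ, Real.dist_eq, ← mul_sub, abs_mul, abs_of_nonneg h1, Real.coe_toNNReal _ h1]
  rfl

end Reparametrization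

/-! ### Quantities depending only on the class of a path. -/

section Paths

variable {n : ℕ}

theorem arcLength_eq (γ : I → EuclideanSpace ℝ (Fin n)) :
    arcLength γ = lengthMeasure (extend γ) (Icc 0 1) := by
  rw [lengthMeasure, withDensity_apply _ measurableSet_Icc]
  rfl

theorem pathCost_eq {S : Set (EuclideanSpace ℝ (Fin n))} {a : ℝ≥0∞}
    {b : EuclideanSpace ℝ (Fin n) → ℝ≥0} (hf : Measurable (friction S a b))
    {γ : I → EuclideanSpace ℝ (Fin n)} (hγ : Continuous γ) :
    pathCost S a b γ =
      ∫⁻ t in Icc 0 1, friction S a b (extend γ t) ∂(lengthMeasure (extend γ)) := by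
  have hfm : Measurable fun t => friction S a b (extend γ t) :=
    hf.comp hγ.Icc_extend'.measurable
  rw [lengthMeasure, restrict_withDensity measurableSet_Icc,
    lintegral_withDensity_eq_lintegral_mul _ (measurable_enorm_deriv _) hfm]
  refine lintegral_congr fun t => ?_
  rw [Pi.mul_apply, mul_comm]
  rfl

theorem exists_orderIso_tendsto {γ₁ γ₂ : LipPath n} (h : dTheta γ₁ γ₂ = 0) :
    ∃ φ : ℕ → I ≃o I,
      ∀ t, Tendsto (fun k => γ₂.toFun (φ k t)) atTop (𝓝 (γ₁.toFun t)) := by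
  have hex : ∀ k : ℕ, ∃ φ : I ≃o I,
      (⨆ t : I, dist (γ₁.toFun t) (γ₂.toFun (φ t))) < 1 / ((k : ℝ) + 1) := fun k => by
    refine exists_lt_of_ciInf_lt ?_
    change dTheta γ₁ γ₂ < _
    rw [h]
    positivity
  choose φ hφ using hex
  refine ⟨φ, fun t => ?_⟩
  rw [tendsto_iff_dist_tendsto_zero]
  refine squeeze_zero (fun _ => dist_nonneg) (fun k => ?_) tendsto_one_div_add_atTop_nhds_zero_nat
  rw [dist_comm]
  exact (le_ciSup (bddAbove_dist γ₁ γ₂ (φ k)) t).trans (hφ k).le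

/-- Endpoints, length and cost of a path depend on its class only. -/
theorem eq_of_dTheta_eq_zero {S : Set (EuclideanSpace ℝ (Fin n))} {a : ℝ≥0∞}
    {b : EuclideanSpace ℝ (Fin n) → ℝ≥0} (hf : Measurable (friction S a b))
    {γ₁ γ₂ : LipPath n} (h : dTheta γ₁ γ₂ = 0) :
    γ₁.toFun 0 = γ₂.toFun 0 ∧ γ₁.toFun 1 = γ₂.toFun 1 ∧
      arcLength γ₁.toFun = arcLength γ₂.toFun ∧
      pathCost S a b γ₁.toFun = pathCost S a b γ₂.toFun := by
  obtain ⟨φ, hφ⟩ := exists_orderIso_tendsto h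
  obtain ⟨ψ, hψ⟩ := exists_orderIso_tendsto (le_antisymm (h ▸ dTheta_comm_le γ₂ γ₁)
    (Real.iInf_nonneg fun φ => iSup_dist_nonneg γ₂ γ₁ φ))
  obtain ⟨K₁, h₁⟩ := γ₁.lipschitz
  obtain ⟨K₂, h₂⟩ := γ₂.lipschitz
  obtain ⟨γ', s₁, s₂, K, hγ', ⟨hm₁, hc₁, hs₁, hf₁⟩, hm₂, hc₂, hs₂, hf₂⟩ :=
    exists_common_reparametrization h₁ h₂ φ ψ hφ hψ
  refine ⟨?_, ?_, ?_, ?_⟩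
  · refine tendsto_nhds_unique (hφ 0) ?_
    simp only [orderIso_zero, tendsto_const_nhds]
  · refine tendsto_nhds_unique (hφ 1) ?_
    simp only [orderIso_one, tendsto_const_nhds]
  · have e₁ := setLIntegral_lengthMeasure_of_comp h₁ hγ' hm₁ hc₁ hs₁ hf₁ measurable_one
    have e₂ := setLIntegral_lengthMeasure_of_comp h₂ hγ' hm₂ hc₂ hs₂ hf₂ measurable_one
    rw [arcLength_eq, arcLength_eq]
    simpa using e₁.trans e₂.symm
  · rw [pathCost_eq hf γ₁.continuous, pathCost_eq hf γ₂.continuous,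
      setLIntegral_lengthMeasure_of_comp h₁ hγ' hm₁ hc₁ hs₁ hf₁ hf,
      setLIntegral_lengthMeasure_of_comp h₂ hγ' hm₂ hc₂ hs₂ hf₂ hf]

end Paths

/-! ### Compactness of path spaces and injective paths. -/

section ShortestPath

variable {E : Type*} [MetricSpace E]

/-- The `K`-Lipschitz paths with values in a set. -/
def lipschitzPaths (K : ℝ≥0) (X : Set E) : Set C(I, E) := {f | LipschitzWith K f ∧ ∀ t, f t ∈ X}

theorem isCompact_lipschitzPaths (K : ℝ≥0) {X : Set E} (hX : IsCompact X) :
    IsCompact (lipschitzPaths K X) := by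
  refine ArzelaAscoli.isCompact_of_equicontinuous _ ?_ ?_
  · have : ContinuousMap.toFun '' (lipschitzPaths K X) =
        (univ.pi fun _ => X) ∩ {f : I → E | LipschitzWith K f} := by
      ext f
      constructor
      · rintro ⟨g, hg, rfl⟩
        exact ⟨fun t _ => hg.2 t, hg.1⟩
      · rintro ⟨h1, h2⟩
        exact ⟨⟨f, h2.continuous⟩, ⟨h2, fun t => h1 t (mem_univ t)⟩, rfl⟩
    rw [this]
    exact (isCompact_univ_pi fun _ => hX).inter_right (isClosed_setOfPred_lipschitzWith K)
  · exact (LipschitzWith.uniformEquicontinuous _ K fun f : lipschitzPaths K X =>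
      f.2.1).equicontinuous

/-- A loop can be cut out of a Lipschitz path. -/
theorem exists_lipschitz_cut {f : I → E} {K : ℝ≥0} (hf : LipschitzWith K f) {s t : I}
    (hst : s < t) (heq : f s = f t) :
    ∃ (K' : ℝ≥0) (h : I → E), (K' : ℝ) = K * (1 - (t - s)) ∧ LipschitzWith K' h ∧ h 0 = f 0 ∧
      h 1 = f 1 ∧ range h ⊆ range f := by
  have hst' : (s : ℝ) < t := hst
  have hs0 : (0 : ℝ) ≤ s := s.2.1
  have ht1 : (t : ℝ) ≤ 1 := t.2.2
  set c : ℝ := 1 - (t - s) with hc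
  have hc0 : 0 ≤ c := by linarith
  set g := extend f with hg
  have hgs : g s = f s := extend_coe f s
  have hgt : g t = f t := extend_coe f t
  have hgL : LipschitzWith K g := hf.extend
  -- The loop on `[s,t]` is skipped, leaving a path on `[0,c]`. Across the jump the Lipschitz
  -- estimate goes through the common value `g s = g t`.
  set δ : ℝ → E := fun u => if u ≤ s then g u else g (u + (t - s)) with hδ
  have hδL : ∀ u v, u ≤ v → dist (δ u) (δ v) ≤ K * (v - u) := fun u v huv => by
    simp only [hδ]
    split_ifs with h1 h2 h2
    · refine (hgL.dist_le_mul _ _).trans_eq ?_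
      rw [dist_comm, Real.dist_eq, abs_of_nonneg (by linarith)]
    · refine (dist_triangle _ (g s) _).trans ?_
      have e1 := hgL.dist_le_mul u s
      have e2 := hgL.dist_le_mul t (v + (t - s))
      rw [dist_comm u, Real.dist_eq, abs_of_nonneg (by linarith)] at e1
      rw [dist_comm (t : ℝ), Real.dist_eq, abs_of_nonneg (by linarith), hgt, ← heq, ← hgs] at e2
      linarith
    · exact absurd (huv.trans h2) h1
    · refine (hgL.dist_le_mul _ _).trans_eq ?_
      rw [dist_comm, Real.dist_eq, abs_of_nonneg (by linarith)]
      ring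
  have hδL' : ∀ u v, dist (δ u) (δ v) ≤ K * dist u v := fun u v => by
    rcases le_total u v with h | h
    · rw [dist_comm u, Real.dist_eq, abs_of_nonneg (by linarith)]
      exact hδL u v h
    · rw [Real.dist_eq, abs_of_nonneg (by linarith), dist_comm]
      exact hδL v u h
  refine ⟨K * c.toNNReal, fun r => δ (c * r), by simp [hc0],
    LipschitzWith.of_dist_le_mul fun u v => ?_, ?_, ?_, ?_⟩
  · refine (hδL' _ _).trans_eq ?_
    rw [Real.dist_eq, ← mul_sub, abs_mul, abs_of_nonneg hc0, NNReal.coe_mul,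
      Real.coe_toNNReal c hc0, mul_assoc]
    rfl
  · have : g 0 = f 0 := extend_coe f 0
    simp [hδ, hs0, this]
  · have h1 : g 1 = f 1 := extend_coe f 1
    simp only [hδ, Icc.coe_one, mul_one]
    -- The first branch, `c ≤ s`, forces `t = 1`; the path then ends at `f s = f t = f 1`.
    split_ifs with h
    · have ht : (t : ℝ) = 1 := le_antisymm ht1 (by linarith)
      have hcs : c = s := by rw [hc, ht]; ring
      rw [hcs, hgs, heq, ← h1, ← ht, hgt]
    · rw [← h1]
      congr 1
      rw [hc]; ring
  · rintro _ ⟨r, rfl⟩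
    simp only [hδ]
    split_ifs <;> exact ⟨_, rfl⟩

/-- Two points joined by a Lipschitz path in a compact set are joined by an injective one there,
or agree. -/
theorem exists_injective_lipschitz {X : Set E} (hX : IsCompact X) {f : I → E} {K : ℝ≥0}
    (hf : LipschitzWith K f) (hfX : ∀ t, f t ∈ X) :
    ∃ (h : I → E) (K' : ℝ≥0), LipschitzWith K' h ∧ h 0 = f 0 ∧ h 1 = f 1 ∧ (∀ t, h t ∈ X) ∧
      (Function.Injective h ∨ ∀ t, h t = f 0) := by
  set D : ℝ≥0 → Set C(I, E) := fun L => lipschitzPaths L X ∩ {h | h 0 = f 0 ∧ h 1 = f 1} with hD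
  -- The path sought has the least Lipschitz constant among those joining the end points in `X`; it
  -- lies in the intersection of the nested compact sets `D L`.
  set A : Set ℝ≥0 := {L | (D L).Nonempty} with hA
  have hDmono : Monotone D := fun L L' hL h hh => ⟨⟨hh.1.1.weaken hL, hh.1.2⟩, hh.2⟩
  have hKA : K ∈ A := ⟨⟨f, hf.continuous⟩, ⟨hf, hfX⟩, rfl, rfl⟩
  have hclosed : IsClosed {h : C(I, E) | h 0 = f 0 ∧ h 1 = f 1} :=
    (isClosed_eq (continuous_eval_const 0) continuous_const).inter
      (isClosed_eq (continuous_eval_const 1) continuous_const)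
  have hDc : ∀ L, IsCompact (D L) := fun L => (isCompact_lipschitzPaths L hX).inter_right hclosed
  have : Nonempty A := ⟨⟨K, hKA⟩⟩
  obtain ⟨h, hh⟩ := IsCompact.nonempty_iInter_of_directed_nonempty_isCompact_isClosed
    (fun L : A => D L)
    (fun L L' => (le_total (L : ℝ≥0) L').elim (fun h => ⟨L, subset_rfl, hDmono h⟩)
      fun h => ⟨L', hDmono h, subset_rfl⟩)
    (fun L => L.2) (fun L => hDc L) (fun L => (hDc L).isClosed)
  have hh' : ∀ L ∈ A, h ∈ D L := fun L hL => mem_iInter.1 hh ⟨L, hL⟩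
  have hLip : LipschitzWith (sInf A) h := by
    refine LipschitzWith.of_dist_le_mul fun s t => ?_
    rcases eq_or_ne s t with rfl | hst
    · simp
    have hpos : 0 < nndist s t := by simpa [pos_iff_ne_zero] using hst
    have : nndist (h s) (h t) / nndist s t ≤ sInf A := by
      refine le_csInf ⟨K, hKA⟩ fun L hL => ?_
      rw [div_le_iff₀ hpos]
      exact (hh' L hL).1.1.nndist_le s t
    rw [div_le_iff₀ hpos] at this
    exact NNReal.coe_le_coe.2 this
  obtain ⟨⟨-, hhX⟩, h0, h1⟩ := hh' K hKA
  refine ⟨h, sInf A, hLip, h0, h1, hhX, ?_⟩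
  by_contra! hcon
  obtain ⟨hni, t₀, ht₀⟩ := hcon
  obtain ⟨s, t, hst, heq⟩ : ∃ s t : I, s < t ∧ h s = h t := by
    simp only [Function.Injective, not_forall] at hni
    obtain ⟨s, t, heq, hne⟩ := hni
    rcases lt_or_gt_of_ne hne with hlt | hlt
    · exact ⟨s, t, hlt, heq⟩
    · exact ⟨t, s, hlt, heq.symm⟩
  -- Cutting a loop scales the constant by `1 - (t - s) < 1`, so minimality forces it to be zero and
  -- the path to be constant.
  obtain ⟨K', η, hK', hηL, hη0, hη1, hηr⟩ := exists_lipschitz_cut hLip hst heq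
  have hK'A : K' ∈ A := ⟨⟨η, hηL.continuous⟩, ⟨hηL, fun r => by
    obtain ⟨q, hq⟩ := hηr ⟨r, rfl⟩
    change η r ∈ X
    exact hq ▸ hhX q⟩, hη0.trans h0, hη1.trans h1⟩
  have hle : (sInf A : ℝ≥0) ≤ K' := csInf_le' hK'A
  have hle' : ((sInf A : ℝ≥0) : ℝ) ≤ (sInf A : ℝ≥0) * (1 - (t - s)) := hK' ▸ hle
  have hst' : (s : ℝ) < t := hst
  have hz : ((sInf A : ℝ≥0) : ℝ) = 0 := by
    have := (sInf A : ℝ≥0).coe_nonneg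
    nlinarith
  refine ht₀ (dist_le_zero.1 ?_)
  have := hLip.dist_le_mul t₀ 0
  rwa [hz, zero_mul, h0] at this

end ShortestPath

/-! ### The cube and the projection onto it. -/

section Cube

variable {n : ℕ}

/-- The coordinatewise projection onto the cube. -/
def clamp (x : EuclideanSpace ℝ (Fin n)) : EuclideanSpace ℝ (Fin n) :=
  WithLp.toLp 2 fun i => max (-1) (min 1 (x i))

theorem clamp_mem_cube (x : EuclideanSpace ℝ (Fin n)) : clamp x ∈ cube n := fun i =>
  ⟨le_max_left _ _, max_le (by norm_num) (min_le_left _ _)⟩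

theorem clamp_eq_self {x : EuclideanSpace ℝ (Fin n)} (hx : x ∈ cube n) : clamp x = x := by
  ext i
  simp [clamp, (hx i).1, (hx i).2]

theorem lipschitzWith_clamp : LipschitzWith 1 (clamp (n := n)) := by
  refine LipschitzWith.of_dist_le_mul fun x y => ?_
  rw [NNReal.coe_one, one_mul, EuclideanSpace.dist_eq, EuclideanSpace.dist_eq]
  refine Real.sqrt_le_sqrt (Finset.sum_le_sum fun i _ => ?_)
  gcongr
  have h : LipschitzWith 1 fun r : ℝ => max (-1) (min 1 r) :=
    (LipschitzWith.id.const_min 1).const_max (-1)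
  have h' := h.dist_le_mul (x i) (y i)
  rwa [NNReal.coe_one, one_mul] at h'

theorem isClosed_cube : IsClosed (cube n) := by
  have : cube n = ⋂ i, {x | x i ∈ Icc (-1 : ℝ) 1} := by ext x; simp [cube]
  rw [this]
  exact isClosed_iInter fun i => isClosed_Icc.preimage (by fun_prop)

theorem isCompact_cube : IsCompact (cube n) := by
  have h : cube n = (fun f : Fin n → ℝ => (WithLp.toLp 2 f : EuclideanSpace ℝ (Fin n))) ''
      univ.pi fun _ => Icc (-1) 1 := by
    ext x
    constructor
    · intro hx
      exact ⟨fun i => x i, fun i _ => hx i, rfl⟩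
    · rintro ⟨f, hf, rfl⟩ i
      exact hf i (mem_univ i)
  rw [h]
  exact (isCompact_univ_pi fun _ => isCompact_Icc).image (PiLp.continuous_toLp 2 _)

theorem convex_cube : Convex ℝ (cube n) := fun x hx y hy s t hs ht hst i => by
  simpa using (convex_Icc (-1 : ℝ) 1) (hx i) (hy i) hs ht hst

end Cube

/-! ### Friction, length bounds and existence of optimal paths. -/

section Friction

variable {n : ℕ} {S : Set (EuclideanSpace ℝ (Fin n))} {a : ℝ≥0∞}
  {b : EuclideanSpace ℝ (Fin n) → ℝ≥0}

theorem friction_of_mem {z : EuclideanSpace ℝ (Fin n)} (hz : z ∈ S) : friction S a b z = b z :=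
  if_pos hz

theorem friction_of_notMem {z : EuclideanSpace ℝ (Fin n)} (hz : z ∉ S) : friction S a b z = a :=
  if_neg hz

theorem friction_le (hb_le : ∀ z ∈ S, (b z : ℝ≥0∞) ≤ a) (z : EuclideanSpace ℝ (Fin n)) :
    friction S a b z ≤ a := by
  by_cases hz : z ∈ S
  · rw [friction_of_mem hz]; exact hb_le z hz
  · rw [friction_of_notMem hz]

theorem setOf_friction_le {l : ℝ≥0∞} (hl : l < a) :
    {z | friction S a b z ≤ l} = sublevel S b l := by
  ext z
  by_cases hz : z ∈ S
  · simp [sublevel, hz, friction_of_mem hz]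
  · simp [sublevel, hz, friction_of_notMem hz, hl]

/-- Below `a` the sublevel sets lie in `S` and are relatively closed there; from `a` on they are the
whole space. -/
theorem measurable_friction (hS_meas : MeasurableSet S) (hb_lsc : LowerSemicontinuousOn b S)
    (hb_le : ∀ z ∈ S, (b z : ℝ≥0∞) ≤ a) : Measurable (friction S a b) := by
  refine measurable_of_Iic fun l => ?_
  change MeasurableSet {z | friction S a b z ≤ l}
  rcases lt_or_ge l a with hl | hl
  · rw [setOf_friction_le hl]
    lift l to ℝ≥0 using hl.ne_top
    obtain ⟨C, hC, hSC⟩ := lowerSemicontinuousOn_iff_preimage_Iic.1 hb_lsc l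
    have : sublevel S b l = S ∩ b ⁻¹' Iic l := by ext z; simp [sublevel]
    rw [this, hSC]
    exact hS_meas.inter hC.measurableSet
  · have : {z | friction S a b z ≤ l} = univ :=
      eq_univ_of_forall fun z => (friction_le hb_le z).trans hl
    rw [this]
    exact MeasurableSet.univ

/-- The cost of the image of a path, counted without multiplicity. -/
theorem setLIntegral_friction_eq (hS_meas : MeasurableSet S) {R : Set (EuclideanSpace ℝ (Fin n))}
    (hR : MeasurableSet R) :
    ∫⁻ z in R, friction S a b z ∂μH[1] =
      (∫⁻ z in R ∩ S, (b z : ℝ≥0∞) ∂(μH[1])) + a * μH[1] (R \ S) := by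
  rw [← lintegral_inter_add_sdiff _ R hS_meas, ← setLIntegral_const]
  congr 1
  · exact setLIntegral_congr_fun (hR.inter hS_meas) fun z hz => friction_of_mem hz.2
  · exact setLIntegral_congr_fun (hR.diff hS_meas) fun z hz => friction_of_notMem hz.2

theorem measurableSet_range_path {γ : I → EuclideanSpace ℝ (Fin n)} (hγ : Continuous γ) :
    MeasurableSet (range γ) :=
  (isCompact_range hγ).isClosed.measurableSet

theorem urbanDist_eq (hS_meas : MeasurableSet S) (x y : EuclideanSpace ℝ (Fin n)) :
    urbanDist S a b x y =
      ⨅ γ ∈ connectingPaths x y, ∫⁻ z in range γ, friction S a b z ∂μH[1] := by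
  refine iInf_congr fun γ => iInf_congr fun hγ => ?_
  obtain ⟨⟨K, hK⟩, -, -⟩ := hγ
  rw [setLIntegral_friction_eq hS_meas (measurableSet_range_path hK.continuous)]

theorem setLIntegral_range_le_pathCost (hf : Measurable (friction S a b))
    {γ : I → EuclideanSpace ℝ (Fin n)} {K : ℝ≥0} (hγ : LipschitzWith K γ) :
    ∫⁻ z in range γ, friction S a b z ∂μH[1] ≤ pathCost S a b γ := by
  rw [pathCost_eq hf hγ.continuous, ← extend_image_Icc]
  exact setLIntegral_image_le hγ.extend measurableSet_Icc hf

theorem urbanDist_le_pathCost (hS_meas : MeasurableSet S) (hf : Measurable (friction S a b))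
    {γ : I → EuclideanSpace ℝ (Fin n)} {K : ℝ≥0} (hγ : LipschitzWith K γ) :
    urbanDist S a b (γ 0) (γ 1) ≤ pathCost S a b γ := by
  rw [urbanDist_eq hS_meas]
  exact (iInf₂_le γ ⟨⟨K, hγ⟩, rfl, rfl⟩).trans (setLIntegral_range_le_pathCost hf hγ)

/-- Only points outside the cube move. They lie off `S` and already carry the maximal friction `a`,
while `clamp` does not increase `μH[1]`. -/
theorem setLIntegral_range_clamp_le (hS_sub : S ⊆ cube n) (hb_le : ∀ z ∈ S, (b z : ℝ≥0∞) ≤ a)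
    {γ : I → EuclideanSpace ℝ (Fin n)} (hγ : Continuous γ) :
    ∫⁻ z in range (clamp ∘ γ), friction S a b z ∂μH[1] ≤
      ∫⁻ z in range γ, friction S a b z ∂μH[1] := by
  have hsub : range (clamp ∘ γ) ⊆ (range γ ∩ cube n) ∪ clamp '' (range γ \ cube n) := by
    rintro _ ⟨t, rfl⟩
    by_cases h : γ t ∈ cube n
    · refine Or.inl ?_
      rw [Function.comp_apply, clamp_eq_self h]
      exact ⟨⟨t, rfl⟩, h⟩
    · exact Or.inr ⟨γ t, ⟨⟨t, rfl⟩, h⟩, rfl⟩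
  have hcm : MeasurableSet (cube n) := isClosed_cube.measurableSet
  calc ∫⁻ z in range (clamp ∘ γ), friction S a b z ∂μH[1]
      ≤ ∫⁻ z in (range γ ∩ cube n) ∪ clamp '' (range γ \ cube n), friction S a b z ∂μH[1] :=
        lintegral_mono_set hsub
    _ ≤ (∫⁻ z in range γ ∩ cube n, friction S a b z ∂μH[1]) +
        ∫⁻ z in clamp '' (range γ \ cube n), friction S a b z ∂μH[1] := lintegral_union_le _ _ _
    _ ≤ (∫⁻ z in range γ ∩ cube n, friction S a b z ∂μH[1]) +
        ∫⁻ z in range γ \ cube n, friction S a b z ∂μH[1] := by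
        refine add_le_add_right ?_ _
        calc ∫⁻ z in clamp '' (range γ \ cube n), friction S a b z ∂μH[1]
            ≤ a * μH[1] (clamp '' (range γ \ cube n)) := by
              rw [← setLIntegral_const]
              exact lintegral_mono fun z => friction_le hb_le z
          _ ≤ a * μH[1] (range γ \ cube n) := by
              refine mul_le_mul_right ?_ a
              simpa using lipschitzWith_clamp.hausdorffMeasure_image_le zero_le_one
                (range γ \ cube n)
          _ = ∫⁻ z in range γ \ cube n, friction S a b z ∂μH[1] := by
              rw [← setLIntegral_const]
              exact setLIntegral_congr_fun ((measurableSet_range_path hγ).diff hcm)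
                fun z hz => (friction_of_notMem fun h => hz.2 (hS_sub h)).symm
    _ = ∫⁻ z in range γ, friction S a b z ∂μH[1] := lintegral_inter_add_sdiff _ _ hcm

/-- The level of the friction coefficient in the length bound. -/
def midLevel (a : ℝ≥0∞) : ℝ≥0∞ := if a = ⊤ then 1 else a / 2

theorem midLevel_lt (ha : a ≠ 0) : midLevel a < a := by
  unfold midLevel
  split_ifs with h
  · rw [h]; exact ENNReal.one_lt_top
  · exact ENNReal.half_lt_self ha h

theorem lengthBound_eq (l : ℝ≥0∞) :
    lengthBound S a b l = μH[1] (sublevel S b (midLevel a)) + l / midLevel a := by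
  unfold lengthBound midLevel
  split_ifs with h
  · simp
  · rw [ENNReal.div_eq_inv_mul (b := a / 2), ENNReal.inv_div (by simp) (by simp)]

theorem midLevel_ne_zero (ha : a ≠ 0) : midLevel a ≠ 0 := by
  unfold midLevel
  split_ifs with h
  · exact one_ne_zero
  · simp [ha]

theorem lengthBound_mono {l l' : ℝ≥0∞} (h : l ≤ l') :
    lengthBound S a b l ≤ lengthBound S a b l' := by
  unfold lengthBound
  split_ifs <;> gcongr

theorem lengthBound_lt_top (ha : a ≠ 0) (hfin : ∀ l : ℝ≥0∞, l < a → μH[1] (sublevel S b l) < ⊤)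
    {l : ℝ≥0∞} (hl : l ≠ ⊤) : lengthBound S a b l < ⊤ := by
  rw [lengthBound_eq]
  exact ENNReal.add_lt_top.2
    ⟨hfin _ (midLevel_lt ha), (ENNReal.div_lt_top hl (midLevel_ne_zero ha))⟩

/-- Chebyshev's inequality: off the sublevel set of `midLevel a`, each unit of length costs at least
that level. -/
theorem hausdorffMeasure_le_lengthBound (ha : a ≠ 0) (hf : Measurable (friction S a b))
    (R : Set (EuclideanSpace ℝ (Fin n))) :
    μH[1] R ≤ lengthBound S a b (∫⁻ z in R, friction S a b z ∂μH[1]) := by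
  have hT : {z | friction S a b z ≤ midLevel a} = sublevel S b (midLevel a) :=
    setOf_friction_le (midLevel_lt ha)
  have hTm : MeasurableSet (sublevel S b (midLevel a)) :=
    hT ▸ measurableSet_le hf measurable_const
  rw [lengthBound_eq, ← measure_inter_add_sdiff R hTm]
  refine add_le_add (measure_mono inter_subset_right) ?_
  rw [ENNReal.le_div_iff_mul_le (Or.inl (midLevel_ne_zero ha))
    (Or.inl (midLevel_lt ha).ne_top), mul_comm, ← setLIntegral_const]
  refine le_trans ?_ (lintegral_mono_set (sdiff_subset (s := R) (t := sublevel S b (midLevel a))))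
  have hsub : R \ sublevel S b (midLevel a) = R ∩ {z | midLevel a < friction S a b z} := by
    rw [← hT]
    ext z
    simp
  rw [hsub, inter_comm, ← Measure.restrict_restrict (measurableSet_lt measurable_const hf)]
  exact setLIntegral_mono hf fun z hz => le_of_lt hz

/-- A path can be replaced by one in the cube whose cost, with multiplicity, is no larger, and
whose length is controlled. -/
theorem exists_lipPath_pathCost_le (hS_sub : S ⊆ cube n) (ha : a ≠ 0)
    (hf : Measurable (friction S a b)) (hb_le : ∀ z ∈ S, (b z : ℝ≥0∞) ≤ a)
    {x y : EuclideanSpace ℝ (Fin n)} (hx : x ∈ cube n) (hy : y ∈ cube n)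
    {γ : I → EuclideanSpace ℝ (Fin n)} (hγ : γ ∈ connectingPaths x y) :
    ∃ (η : I → EuclideanSpace ℝ (Fin n)) (K : ℝ≥0), LipschitzWith K η ∧ η 0 = x ∧ η 1 = y ∧
      (∀ t, η t ∈ cube n) ∧
      pathCost S a b η ≤ ∫⁻ z in range γ, friction S a b z ∂μH[1] ∧
      arcLength η ≤ lengthBound S a b (∫⁻ z in range γ, friction S a b z ∂μH[1]) := by
  obtain ⟨⟨K, hK⟩, h0, h1⟩ := hγ
  have hcl : LipschitzWith (1 * K) (clamp ∘ γ) := lipschitzWith_clamp.comp hK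
  obtain ⟨η, K', hη, hη0, hη1, hηX, hinj⟩ := exists_injective_lipschitz
    (isCompact_range hcl.continuous) hcl (fun t => mem_range_self t)
  have hrange : range η ⊆ range (clamp ∘ γ) := range_subset_iff.2 hηX
  have hU : ∫⁻ z in range η, friction S a b z ∂μH[1] ≤
      ∫⁻ z in range γ, friction S a b z ∂μH[1] :=
    (lintegral_mono_set hrange).trans (setLIntegral_range_clamp_le hS_sub hb_le hK.continuous)
  -- Used with the friction to compare costs, and with `f = 1` to identify the length with `μH[1]
  -- (range η)`.
  have harea : ∀ f : EuclideanSpace ℝ (Fin n) → ℝ≥0∞, Measurable f →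
      ∫⁻ t in Icc 0 1, f (extend η t) ∂(lengthMeasure (extend η)) =
        ∫⁻ z in range η, f z ∂μH[1] := fun f hfm => by
    rw [← extend_image_Icc]
    rcases hinj with hinj | hconst
    · refine setLIntegral_image_eq_of_injOn hη.extend zero_le_one (fun s hs t ht hst => ?_) hfm
      rw [extend_apply_of_mem _ hs, extend_apply_of_mem _ ht] at hst
      exact congrArg Subtype.val (hinj hst)
    · refine le_antisymm ?_ (setLIntegral_image_le hη.extend measurableSet_Icc hfm)
      have hz : lengthMeasure (extend η) (Icc 0 1) = 0 := by
        rw [← eVariationOn_Icc_eq_lengthMeasure hη.extend zero_le_one]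
        refine eVariationOn.constant_on ?_
        rw [extend_image_Icc]
        rintro _ ⟨s, rfl⟩ _ ⟨t, rfl⟩
        rw [hconst s, hconst t]
      rw [setLIntegral_measure_zero _ _ hz]
      exact zero_le
  refine ⟨η, K', hη, ?_, ?_, fun t => ?_, ?_, ?_⟩
  · rw [hη0, Function.comp_apply, h0, clamp_eq_self hx]
  · rw [hη1, Function.comp_apply, h1, clamp_eq_self hy]
  · obtain ⟨s, hs⟩ := hηX t
    exact hs ▸ clamp_mem_cube _
  · rw [pathCost_eq hf hη.continuous, harea _ hf]
    exact hU
  · have h := harea _ measurable_one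
    simp only [Pi.one_apply, setLIntegral_one] at h
    rw [arcLength_eq, h]
    exact (hausdorffMeasure_le_lengthBound ha hf _).trans (lengthBound_mono hU)

/-- The constant speed version of a path has the same cost. -/
theorem exists_lipschitzWith_arcLength (hf : Measurable (friction S a b))
    {η : I → EuclideanSpace ℝ (Fin n)} {K : ℝ≥0} (hη : LipschitzWith K η) :
    ∃ ζ : I → EuclideanSpace ℝ (Fin n), LipschitzWith (arcLength η).toNNReal ζ ∧
      ζ 0 = η 0 ∧ ζ 1 = η 1 ∧ range ζ = range η ∧ pathCost S a b ζ = pathCost S a b η := by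
  obtain ⟨ζ, s, hζ, hm, hc, hs, hfac, -⟩ := exists_constantSpeed hη
  have hlen : arcLength η = ENNReal.ofReal (arcParam (extend η) 1) := by
    rw [arcLength_eq, lengthMeasure_Icc hη.extend zero_le_one, arcParam_zero, sub_zero]
  have hs0 : s 0 = 0 := by
    obtain ⟨t, ht⟩ := hs 0
    exact le_antisymm ((hm (show 0 ≤ t from t.2.1)).trans_eq ht) (s 0).2.1
  have hs1 : s 1 = 1 := by
    obtain ⟨t, ht⟩ := hs 1
    exact le_antisymm (s 1).2.2 (ht.ge.trans (hm (show t ≤ 1 from t.2.2)))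
  have hcomp : ζ ∘ s = η := funext hfac
  refine ⟨ζ, ?_, ?_, ?_, ?_, ?_⟩
  · rw [hlen]; exact hζ
  · rw [← hfac, hs0]
  · rw [← hfac, hs1]
  · rw [← hcomp, hs.range_comp]
  · rw [pathCost_eq hf hζ.continuous, pathCost_eq hf hη.continuous,
      setLIntegral_lengthMeasure_of_comp hη hζ hm hc hs hfac hf]

/-- The cost is lower semicontinuous on sets of uniformly Lipschitz paths. -/
theorem isClosed_pathCost_le (hf : Measurable (friction S a b))
    (hb_le : ∀ z ∈ S, (b z : ℝ≥0∞) ≤ a)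
    (hfin : ∀ l : ℝ≥0∞, l < a → μH[1] (sublevel S b l) < ⊤) (M : ℝ≥0) (r : ℝ≥0∞) :
    IsClosed {f : C(I, EuclideanSpace ℝ (Fin n)) |
      f ∈ lipschitzPaths M (cube n) ∧ pathCost S a b f ≤ r} := by
  refine isSeqClosed_iff_isClosed.1 fun fs f hfs hlim => ?_
  have hfM : f ∈ lipschitzPaths M (cube n) :=
    (isCompact_lipschitzPaths M isCompact_cube).isClosed.mem_of_tendsto hlim
      (Eventually.of_forall fun k => (hfs k).1)
  refine ⟨hfM, ?_⟩
  have hunif : TendstoUniformlyOn (fun k => extend (fs k)) (extend f) atTop (Icc 0 1) :=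
    ((ContinuousMap.tendsto_iff_tendstoUniformly.1 hlim).comp (projIcc 0 1 zero_le_one))
      |>.tendstoUniformlyOn
  rw [pathCost_eq hf f.continuous]
  refine (setLIntegral_lengthMeasure_le_liminf hfM.1.extend
    (fun k => ⟨M, (hfs k).1.1.extend⟩) zero_le_one hunif hf (friction_le hb_le)
    (fun l hl => by rw [setOf_friction_le hl]; exact hfin l hl)).trans ?_
  refine liminf_le_of_frequently_le' (Frequently.of_forall fun k => ?_)
  rw [← pathCost_eq hf (fs k).continuous]
  exact (hfs k).2

/-- The near-optimal paths of cost at most `r`, for `r` above the distance, form nested nonempty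
compact sets; a common point is optimal. -/
theorem exists_mem_lipschitzPaths_pathCost_le (hS_sub : S ⊆ cube n) (hS_meas : MeasurableSet S)
    (ha : a ≠ 0) (hf : Measurable (friction S a b)) (hb_le : ∀ z ∈ S, (b z : ℝ≥0∞) ≤ a)
    (hfin : ∀ l : ℝ≥0∞, l < a → μH[1] (sublevel S b l) < ⊤)
    {x y : EuclideanSpace ℝ (Fin n)} (hx : x ∈ cube n) (hy : y ∈ cube n) {L : ℝ≥0∞} (hL : L ≠ ⊤)
    (hd : urbanDist S a b x y < L) :
    ∃ f ∈ lipschitzPaths (lengthBound S a b L).toNNReal (cube n), f 0 = x ∧ f 1 = y ∧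
      pathCost S a b f ≤ urbanDist S a b x y := by
  set M := (lengthBound S a b L).toNNReal with hM
  set d := urbanDist S a b x y
  set D : Ioi d → Set C(I, EuclideanSpace ℝ (Fin n)) := fun r =>
    {f | f ∈ lipschitzPaths M (cube n) ∧ pathCost S a b f ≤ r} ∩ {f | f 0 = x ∧ f 1 = y} with hD
  have hDmono : Monotone D := fun r r' h f hf => ⟨⟨hf.1.1, hf.1.2.trans h⟩, hf.2⟩
  have hclosed : ∀ r, IsClosed (D r) := fun r =>
    (isClosed_pathCost_le hf hb_le hfin M r).inter
      ((isClosed_eq (continuous_eval_const 0) continuous_const).inter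
        (isClosed_eq (continuous_eval_const 1) continuous_const))
  have hne : ∀ r, (D r).Nonempty := fun r => by
    -- The bound by `L` keeps the Lipschitz constant independent of `r`.
    have hlt : urbanDist S a b x y < min L r := lt_min hd r.2
    rw [urbanDist_eq hS_meas] at hlt
    simp only [iInf_lt_iff] at hlt
    obtain ⟨γ, hγ, hlt⟩ := hlt
    obtain ⟨η, K, hη, h0, h1, hcube, hcost, hlen⟩ :=
      exists_lipPath_pathCost_le hS_sub ha hf hb_le hx hy hγ
    obtain ⟨ζ, hζ, hζ0, hζ1, hζr, hζc⟩ := exists_lipschitzWith_arcLength hf hη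
    refine ⟨⟨ζ, hζ.continuous⟩, ⟨⟨hζ.weaken ?_, fun t => ?_⟩, ?_⟩, hζ0.trans h0, hζ1.trans h1⟩
    · exact ENNReal.toNNReal_mono (lengthBound_lt_top ha hfin hL).ne
        (hlen.trans (lengthBound_mono (hlt.le.trans (min_le_left _ _))))
    · have : ζ t ∈ range η := hζr ▸ mem_range_self t
      obtain ⟨s, hs⟩ := this
      change ζ t ∈ cube n
      exact hs ▸ hcube s
    · change pathCost S a b ζ ≤ r
      rw [hζc]
      exact hcost.trans (hlt.le.trans (min_le_right _ _))
  have : Nonempty (Ioi d) := ⟨⟨L, hd⟩⟩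
  obtain ⟨f, hfm⟩ := IsCompact.nonempty_iInter_of_directed_nonempty_isCompact_isClosed D
    (fun r r' => (le_total r r').elim (fun h => ⟨r, subset_rfl, hDmono h⟩)
      fun h => ⟨r', hDmono h, subset_rfl⟩) hne
    (fun r => (isCompact_lipschitzPaths M isCompact_cube).of_isClosed_subset (hclosed r)
      fun f hf => hf.1.1) hclosed
  have hfD : ∀ r, f ∈ D r := mem_iInter.1 hfm
  obtain ⟨⟨hfM, -⟩, h0, h1⟩ := hfD ⟨L, hd⟩
  exact ⟨f, hfM, h0, h1, le_of_forall_gt_imp_ge_of_dense fun r hr => (hfD ⟨r, hr⟩).1.2⟩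

end Friction

/-! ### Measurable selection from compact fibres. -/

section Selection

variable {P Z : Type*} [TopologicalSpace Z] [T2Space Z] [MeasurableSpace Z] [BorelSpace Z]

/-- A lower semicontinuous `F` attains its minimum on each nonempty compact fibre. That this minimum
is at most `d z` can be tested against rational levels, using images of compact sets, which are
closed. -/
theorem measurableSet_exists_le [TopologicalSpace P] {e : P → Z} (he : Continuous e)
    {F : P → ℝ≥0∞} (hF : LowerSemicontinuous F) {d : Z → ℝ≥0∞} (hd : Measurable d)
    {Q : Set P} (hQ : IsCompact Q) : MeasurableSet {z | ∃ q ∈ Q, e q = z ∧ F q ≤ d z} := by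
  have himg : ∀ r, MeasurableSet (e '' (Q ∩ F ⁻¹' Iic r)) := fun r =>
    ((hQ.inter_right (hF.isClosed_preimage r)).image he).isClosed.measurableSet
  have : {z | ∃ q ∈ Q, e q = z ∧ F q ≤ d z} = e '' Q ∩ ⋂ r : ℚ,
      ({z | ENNReal.ofReal r ≤ d z} ∪ e '' (Q ∩ F ⁻¹' Iic (ENNReal.ofReal r))) := by
    ext z
    constructor
    · rintro ⟨q, hq, rfl, hle⟩
      refine ⟨⟨q, hq, rfl⟩, mem_iInter.2 fun r => ?_⟩
      rcases le_total (ENNReal.ofReal r) (d (e q)) with h | h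
      · exact Or.inl h
      · exact Or.inr ⟨q, ⟨hq, hle.trans h⟩, rfl⟩
    · rintro ⟨⟨q₀, hq₀, hz⟩, hr⟩
      have hc : IsCompact (Q ∩ e ⁻¹' {z}) := hQ.inter_right (isClosed_singleton.preimage he)
      obtain ⟨q, ⟨hqQ, hqz⟩, hmin⟩ :=
        LowerSemicontinuousOn.exists_isMinOn (show (Q ∩ e ⁻¹' {z}).Nonempty from ⟨q₀, hq₀, hz⟩) hc
          (hF.lowerSemicontinuousOn _)
      refine ⟨q, hqQ, hqz, ?_⟩
      by_contra! hlt
      obtain ⟨r, -, h1, h2⟩ := ENNReal.lt_iff_exists_rat_btwn.1 hlt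
      rcases mem_iInter.1 hr r with h | ⟨q', ⟨hq', hle⟩, hz'⟩
      · exact absurd (h1.trans_le h) (lt_irrefl _)
      · exact absurd ((isMinOn_iff.1 hmin q' ⟨hq', hz'⟩).trans hle) (not_le.2 h2)
  rw [this]
  refine (hQ.image he).isClosed.measurableSet.inter (MeasurableSet.iInter fun r => ?_)
  exact (measurableSet_le measurable_const hd).union (himg _)

/-- Measurable selection of points in the fibres of `e` with `F ≤ d`. -/
theorem exists_measurable_selection [MetricSpace P] [CompactSpace P] [Nonempty P]
    [MeasurableSpace P] [BorelSpace P] {e : P → Z} (he : Continuous e)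
    {F : P → ℝ≥0∞} (hF : LowerSemicontinuous F) {d : Z → ℝ≥0∞} (hd : Measurable d) :
    ∃ sel : Z → P, Measurable sel ∧
      ∀ z, (∃ p, e p = z ∧ F p ≤ d z) → e (sel z) = z ∧ F (sel z) ≤ d z := by
  obtain ⟨ψ₀, hψ₀, hψ₀s⟩ := exists_nat_bool_continuous_surjective_of_compact P
  -- Pulling back to a compact subset of ℝ provides a linear order in which nonempty closed sets
  -- have a least element.
  set ψ : cantorSet → P := ψ₀ ∘ cantorSetHomeomorphNatToBool with hψ
  have hψc : Continuous ψ := hψ₀.comp cantorSetHomeomorphNatToBool.continuous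
  have hψs : Function.Surjective ψ := hψ₀s.comp cantorSetHomeomorphNatToBool.surjective
  have : CompactSpace cantorSet := isCompact_iff_compactSpace.1 isCompact_cantorSet
  have he' : Continuous (e ∘ ψ) := he.comp hψc
  have hF' : LowerSemicontinuous (F ∘ ψ) := hF.comp hψc
  set A : Z → Set cantorSet := fun z => {q | (e ∘ ψ) q = z ∧ (F ∘ ψ) q ≤ d z} with hA
  have hAc : ∀ z, IsCompact (A z) := fun z =>
    ((isClosed_singleton.preimage he').inter (hF'.isClosed_preimage (d z))).isCompact
  have hleast : ∀ z, (A z).Nonempty → ∃ q, IsLeast (A z) q := fun z hz => (hAc z).exists_isLeast hz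
  have hB : ∀ Q : Set cantorSet, IsClosed Q → MeasurableSet {z | ∃ q ∈ Q, q ∈ A z} := fun Q hQ =>
    measurableSet_exists_le he' hF' hd hQ.isCompact
  classical
  set q₀ : cantorSet := ⟨0, zero_mem_cantorSet⟩
  set τ : Z → cantorSet := fun z => if h : (A z).Nonempty then (hleast z h).choose else q₀ with hτ
  have hτmem : ∀ z, (A z).Nonempty → IsLeast (A z) (τ z) := fun z h => by
    simp only [hτ, dif_pos h]
    exact (hleast z h).choose_spec
  have hτm : Measurable τ := by
    refine Measurable.subtype_mk (f := fun z => (τ z : ℝ)) (measurable_of_Iic fun c => ?_)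
    -- The least admissible parameter is at most `c` exactly when some admissible one is. The second
    -- set accounts for the default value `0` on empty fibres.
    have hset : (fun z => (τ z : ℝ)) ⁻¹' Iic c =
        {z | ∃ q ∈ {q : cantorSet | (q : ℝ) ≤ c}, q ∈ A z} ∪
          ({z | ∃ q ∈ (univ : Set cantorSet), q ∈ A z}ᶜ ∩ {_z | (0 : ℝ) ≤ c}) := by
      ext z
      by_cases h : (A z).Nonempty
      · have hl := hτmem z h
        constructor
        · exact fun hz => Or.inl ⟨τ z, hz, hl.1⟩
        · rintro (⟨q, hq, hqA⟩ | ⟨hz, -⟩)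
          · exact le_trans (show (τ z : ℝ) ≤ q from hl.2 hqA) hq
          · exact absurd ⟨τ z, mem_univ _, hl.1⟩ hz
      · have hz : (τ z : ℝ) = 0 := by simp only [hτ, dif_neg h, q₀]
        have h1 : ¬∃ q ∈ {q : cantorSet | (q : ℝ) ≤ c}, q ∈ A z := fun ⟨q, _, hq⟩ => h ⟨q, hq⟩
        have h2 : ¬∃ q ∈ (univ : Set cantorSet), q ∈ A z := fun ⟨q, _, hq⟩ => h ⟨q, hq⟩
        rw [mem_preimage, mem_Iic, hz]
        constructor
        · exact fun hc => Or.inr ⟨h2, hc⟩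
        · rintro (h' | h')
          · exact absurd h' h1
          · exact h'.2
    rw [hset]
    exact (hB _ (isClosed_Iic.preimage continuous_subtype_val)).union
      ((hB _ isClosed_univ).compl.inter (MeasurableSet.const _))
  refine ⟨fun z => ψ (τ z), hψc.measurable.comp hτm, fun z ⟨p, hp, hle⟩ => ?_⟩
  obtain ⟨q, rfl⟩ := hψs p
  exact (hτmem z ⟨q, hp, hle⟩).1

end Selection

/-! ### From continuous paths to path classes. -/

section Theta

variable {n : ℕ}

/-- The Lipschitz paths in the cube, as a subset of the space of continuous paths. -/
def cubePaths (n : ℕ) : Set C(I, EuclideanSpace ℝ (Fin n)) := ⋃ K, lipschitzPaths K (cube n)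

instance : MeasurableSpace (cubePaths n) := borel _

instance : BorelSpace (cubePaths n) := ⟨rfl⟩

/-- The path underlying an element of `cubePaths`. -/
def toLipPath (f : cubePaths n) : LipPath n where
  toFun := f.1
  lipschitz := (mem_iUnion.1 f.2).imp fun _ h => h.1
  mem_cube := (mem_iUnion.1 f.2).elim fun _ h => h.2

/-- The identity reparametrization shows that `dTheta` is at most the uniform distance. -/
theorem continuous_pathClass_toLipPath :
    Continuous fun f : cubePaths n => pathClass (toLipPath f) := by
  refine SeparationQuotient.continuous_mk.comp
    (LipschitzWith.of_dist_le_mul (K := 1) fun f g => ?_).continuous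
  refine (dTheta_le _ _ (OrderIso.refl I)).trans (ciSup_le fun t => ?_)
  rw [NNReal.coe_one, one_mul]
  exact ContinuousMap.dist_apply_le_dist t

/-- The segment between two points of the cube. -/
def segmentPath (z : cube n × cube n) : C(I, EuclideanSpace ℝ (Fin n)) where
  toFun t := AffineMap.lineMap (z.1 : EuclideanSpace ℝ (Fin n))
    (z.2 : EuclideanSpace ℝ (Fin n)) (t : ℝ)
  continuous_toFun := by fun_prop

theorem segmentPath_mem (z : cube n × cube n) : segmentPath z ∈ cubePaths n := by
  refine mem_iUnion.2 ⟨_, (lipschitzWith_lineMap (𝕜 := ℝ) (z.1 : EuclideanSpace ℝ (Fin n))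
    (z.2 : EuclideanSpace ℝ (Fin n))).comp (LipschitzWith.subtype_val _), fun t => ?_⟩
  exact convex_cube.lineMap_mem z.1.2 z.2.2 t.2

theorem continuous_segmentPath : Continuous (segmentPath (n := n)) := by
  refine ContinuousMap.continuous_of_continuous_uncurry _ ?_
  change Continuous fun p : (cube n × cube n) × I => AffineMap.lineMap
    (p.1.1 : EuclideanSpace ℝ (Fin n)) (p.1.2 : EuclideanSpace ℝ (Fin n)) (p.2 : ℝ)
  simp only [AffineMap.lineMap_apply_module]
  fun_prop

theorem segmentPath_zero (z : cube n × cube n) : segmentPath z 0 = z.1 := by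
  change AffineMap.lineMap _ _ ((0 : I) : ℝ) = _
  simp

theorem segmentPath_one (z : cube n × cube n) : segmentPath z 1 = z.2 := by
  change AffineMap.lineMap _ _ ((1 : I) : ℝ) = _
  simp

end Theta

/-! ### Measurable choice of optimal paths. -/

section Main

variable {n : ℕ} {S : Set (EuclideanSpace ℝ (Fin n))} {a : ℝ≥0∞}
  {b : EuclideanSpace ℝ (Fin n) → ℝ≥0}

/-- It suffices to choose one representative of each class, measurably in the space of continuous
paths. -/
theorem exists_of_measurable_selection (hf : Measurable (friction S a b))
    (h : ∃ sel : cube n × cube n → cubePaths n, Measurable sel ∧ ∀ z : cube n × cube n,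
      pathCost S a b (sel z).1 = urbanDist S a b z.1 z.2 ∧ (sel z).1 0 = z.1 ∧ (sel z).1 1 = z.2 ∧
      arcLength (sel z).1 ≤ lengthBound S a b (urbanDist S a b z.1 z.2 + 1)) :
    ∃ ρ : cube n × cube n → Theta n, Measurable ρ ∧ ∀ x y : cube n, ∀ γ : LipPath n,
      pathClass γ = ρ (x, y) →
        pathCost S a b γ.toFun = urbanDist S a b x y ∧ γ.toFun 0 = x ∧ γ.toFun 1 = y ∧
        arcLength γ.toFun ≤ lengthBound S a b (urbanDist S a b x y + 1) := by
  obtain ⟨sel, hs, hsp⟩ := h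
  refine ⟨fun z => pathClass (toLipPath (sel z)), continuous_pathClass_toLipPath.measurable.comp hs,
    fun x y γ hγ => ?_⟩
  obtain ⟨h0, h1, hlen, hcost⟩ := eq_of_dTheta_eq_zero hf ((pathClass_eq_iff _ _).1 hγ)
  rw [h0, h1, hlen, hcost]
  exact hsp (x, y)

theorem arcLength_le_of_lipschitzWith {γ : I → EuclideanSpace ℝ (Fin n)} {M : ℝ≥0}
    (hγ : LipschitzWith M γ) : arcLength γ ≤ M := by
  refine (setLIntegral_mono measurable_const fun t _ => ?_ :
    arcLength γ ≤ ∫⁻ _ in Icc (0 : ℝ) 1, (M : ℝ≥0∞)).trans ?_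
  · exact enorm_le_coe.2 (norm_deriv_le_of_lipschitz hγ.extend)
  · simp

/-- For finite `r`, the pairs at distance at most `r` are the end points of a compact set of paths,
hence form a closed set. -/
theorem measurable_urbanDist (hS_sub : S ⊆ cube n) (hS_meas : MeasurableSet S)
    (ha : a ≠ 0) (hf : Measurable (friction S a b)) (hb_le : ∀ z ∈ S, (b z : ℝ≥0∞) ≤ a)
    (hfin : ∀ l : ℝ≥0∞, l < a → μH[1] (sublevel S b l) < ⊤) :
    Measurable fun z : cube n × cube n => urbanDist S a b z.1 z.2 := by
  refine measurable_of_Iic fun r => ?_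
  by_cases hr : r = ⊤
  · simp [hr]
  set M := (lengthBound S a b (r + 1)).toNNReal
  have hC : IsCompact {f : C(I, EuclideanSpace ℝ (Fin n)) |
      f ∈ lipschitzPaths M (cube n) ∧ pathCost S a b f ≤ r} :=
    (isCompact_lipschitzPaths M isCompact_cube).of_isClosed_subset
      (isClosed_pathCost_le hf hb_le hfin M r) fun f hf => hf.1
  have hcont : Continuous fun f : C(I, EuclideanSpace ℝ (Fin n)) => (f 0, f 1) :=
    (continuous_eval_const 0).prodMk (continuous_eval_const 1)
  have hset : (fun z : cube n × cube n => urbanDist S a b z.1 z.2) ⁻¹' Iic r =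
      (fun z : cube n × cube n => ((z.1 : EuclideanSpace ℝ (Fin n)),
        (z.2 : EuclideanSpace ℝ (Fin n)))) ⁻¹' ((fun f => (f 0, f 1)) ''
          {f : C(I, EuclideanSpace ℝ (Fin n)) |
            f ∈ lipschitzPaths M (cube n) ∧ pathCost S a b f ≤ r}) := by
    ext z
    constructor
    · intro hz
      -- The level `r + 1` supplies the strict inequality needed for the length bound.
      obtain ⟨f, hfM, h0, h1, hfc⟩ := exists_mem_lipschitzPaths_pathCost_le hS_sub hS_meas ha hf
        hb_le hfin z.1.2 z.2.2 (L := r + 1) (by simp [hr])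
        (lt_of_le_of_lt hz (ENNReal.lt_add_right hr one_ne_zero))
      exact ⟨f, ⟨hfM, hfc.trans hz⟩, Prod.ext h0 h1⟩
    · rintro ⟨f, ⟨hfM, hfc⟩, hfz⟩
      obtain ⟨h0, h1⟩ := Prod.mk.inj hfz
      have := urbanDist_le_pathCost hS_meas hf hfM.1
      rw [h0, h1] at this
      exact this.trans hfc
  rw [hset]
  exact (hC.image hcont).isClosed.measurableSet.preimage (by fun_prop)

/-- Measurable choice of optimal paths of length at most `lengthBound S a b L`, where the urban
distance is less than `L`. -/
theorem exists_measurable_optimal (hS_sub : S ⊆ cube n) (hS_meas : MeasurableSet S)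
    (ha : a ≠ 0) (hf : Measurable (friction S a b)) (hb_le : ∀ z ∈ S, (b z : ℝ≥0∞) ≤ a)
    (hfin : ∀ l : ℝ≥0∞, l < a → μH[1] (sublevel S b l) < ⊤) {L : ℝ≥0∞} (hL : L ≠ ⊤) :
    ∃ sel : cube n × cube n → cubePaths n, Measurable sel ∧ ∀ z : cube n × cube n,
      urbanDist S a b z.1 z.2 < L →
      pathCost S a b (sel z).1 = urbanDist S a b z.1 z.2 ∧ (sel z).1 0 = z.1 ∧ (sel z).1 1 = z.2 ∧
      arcLength (sel z).1 ≤ lengthBound S a b L := by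
  set M := (lengthBound S a b L).toNNReal with hM
  set P := lipschitzPaths M (cube n) with hP
  have : CompactSpace P := isCompact_iff_compactSpace.1 (isCompact_lipschitzPaths M isCompact_cube)
  have hzero : (0 : EuclideanSpace ℝ (Fin n)) ∈ cube n := fun i => by simp
  have : Nonempty P := ⟨⟨ContinuousMap.const I 0, LipschitzWith.const' 0, fun _ => hzero⟩⟩
  have hlsc : LowerSemicontinuous fun f : P => pathCost S a b f.1 := by
    refine lowerSemicontinuous_iff_isClosed_preimage.2 fun r => ?_
    have : (fun f : P => pathCost S a b f.1) ⁻¹' Iic r = Subtype.val ⁻¹'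
        {f : C(I, EuclideanSpace ℝ (Fin n)) | f ∈ P ∧ pathCost S a b f ≤ r} := by
      ext f
      exact ⟨fun h => ⟨f.2, h⟩, fun h => h.2⟩
    rw [this]
    exact (isClosed_pathCost_le hf hb_le hfin M r).preimage continuous_subtype_val
  set e : P → cube n × cube n := fun f => (⟨f.1 0, f.2.2 0⟩, ⟨f.1 1, f.2.2 1⟩) with he
  have hec : Continuous e :=
    (((continuous_eval_const 0).comp continuous_subtype_val).subtype_mk _).prodMk
      (((continuous_eval_const 1).comp continuous_subtype_val).subtype_mk _)
  let _ : MeasurableSpace P := borel P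
  have : BorelSpace P := ⟨rfl⟩
  obtain ⟨sel, hs, hsp⟩ := exists_measurable_selection hec hlsc
    (measurable_urbanDist hS_sub hS_meas ha hf hb_le hfin)
  have hincl : Continuous fun f : P => (⟨f.1, mem_iUnion.2 ⟨M, f.2⟩⟩ : cubePaths n) :=
    continuous_subtype_val.subtype_mk _
  refine ⟨_, hincl.measurable.comp hs, fun z hz => ?_⟩
  obtain ⟨f, hfM, h0, h1, hfc⟩ := exists_mem_lipschitzPaths_pathCost_le hS_sub hS_meas ha hf
    hb_le hfin z.1.2 z.2.2 hL hz
  obtain ⟨hez, hcost⟩ := hsp z ⟨⟨f, hfM⟩, Prod.ext (Subtype.ext h0) (Subtype.ext h1), hfc⟩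
  have h0' : (sel z).1 0 = z.1 := congrArg (fun w : cube n × cube n => w.1.1) hez
  have h1' : (sel z).1 1 = z.2 := congrArg (fun w : cube n × cube n => w.2.1) hez
  have hge := urbanDist_le_pathCost hS_meas hf (sel z).2.1
  rw [h0', h1'] at hge
  refine ⟨le_antisymm hcost hge, h0', h1', ?_⟩
  refine (arcLength_le_of_lipschitzWith (sel z).2.1).trans_eq ?_
  rw [hM, ENNReal.coe_toNNReal (lengthBound_lt_top ha hfin hL).ne]

theorem exists_measurable_representative (hS_sub : S ⊆ cube n) (hS_meas : MeasurableSet S)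
    (hf : Measurable (friction S a b)) (hb_le : ∀ z ∈ S, (b z : ℝ≥0∞) ≤ a)
    (hfin : ∀ l : ℝ≥0∞, l < a → μH[1] (sublevel S b l) < ⊤) :
    ∃ sel : cube n × cube n → cubePaths n, Measurable sel ∧ ∀ z : cube n × cube n,
      pathCost S a b (sel z).1 = urbanDist S a b z.1 z.2 ∧ (sel z).1 0 = z.1 ∧ (sel z).1 1 = z.2 ∧
      arcLength (sel z).1 ≤ lengthBound S a b (urbanDist S a b z.1 z.2 + 1) := by
  set seg : cube n × cube n → cubePaths n := fun z => ⟨segmentPath z, segmentPath_mem z⟩ with hseg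
  have hsegm : Measurable seg := (continuous_segmentPath.subtype_mk _).measurable
  have hsegd : ∀ z : cube n × cube n,
      urbanDist S a b z.1 z.2 ≤ pathCost S a b (segmentPath z) := fun z => by
    obtain ⟨K, hK⟩ := mem_iUnion.1 (segmentPath_mem z)
    have := urbanDist_le_pathCost hS_meas hf hK.1
    rwa [segmentPath_zero, segmentPath_one] at this
  -- For `a = 0` every path is free and the length bound is infinite, since `2 / 0 = ⊤`; segments
  -- suffice.
  rcases eq_or_ne a 0 with rfl | ha
  · refine ⟨seg, hsegm, fun z => ⟨le_antisymm ?_ (hsegd z), segmentPath_zero z, segmentPath_one z,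
      ?_⟩⟩
    · have h0 : ∀ w, friction S 0 b w = 0 := fun w => nonpos_iff_eq_zero.1 (friction_le hb_le w)
      simp [pathCost, h0]
    · rw [lengthBound, if_neg ENNReal.zero_ne_top, ENNReal.div_zero two_ne_zero,
        ENNReal.top_mul (by simp), add_top]
      exact le_top
  choose sel hs hsp using fun m : ℕ => exists_measurable_optimal hS_sub hS_meas ha hf hb_le hfin
    (L := m + 1) (by simp)
  set d : cube n × cube n → ℝ≥0∞ := fun z => urbanDist S a b z.1 z.2 with hd
  have hdm : Measurable d := measurable_urbanDist hS_sub hS_meas ha hf hb_le hfin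
  classical
  -- With `m` the integer part of `d z`, one has `d z < m + 1 ≤ d z + 1`. So the selection for level
  -- `m + 1` applies and meets the length bound at `d z + 1`. At infinite distance every joining
  -- path is optimal and the bound is infinite.
  refine ⟨fun z => if d z = ⊤ then seg z else sel ⌊(d z).toNNReal⌋₊ z, ?_, fun z => ?_⟩
  · refine Measurable.ite (hdm (measurableSet_singleton ⊤)) hsegm ?_
    have h1 : Measurable fun p : ℕ × (cube n × cube n) => sel p.1 p.2 :=
      measurable_from_prod_countable_right hs
    exact h1.comp ((Nat.measurable_floor.comp hdm.ennreal_toNNReal).prodMk measurable_id)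
  · by_cases hz : d z = ⊤
    · simp only [if_pos hz]
      refine ⟨le_antisymm ?_ (hsegd z), segmentPath_zero z, segmentPath_one z, ?_⟩
      · exact le_top.trans_eq hz.symm
      · change _ ≤ lengthBound S a b (d z + 1)
        rw [lengthBound_eq, hz, top_add, ENNReal.top_div_of_ne_top (midLevel_lt ha).ne_top, add_top]
        exact le_top
    · simp only [if_neg hz]
      set m := ⌊(d z).toNNReal⌋₊ with hm
      have hcoe : ((d z).toNNReal : ℝ≥0∞) = d z := ENNReal.coe_toNNReal hz
      have hlt : d z < m + 1 := by
        rw [← hcoe]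
        exact_mod_cast Nat.lt_floor_add_one (d z).toNNReal
      have hle : (m : ℝ≥0∞) ≤ d z := by
        rw [← hcoe]
        exact_mod_cast Nat.floor_le (zero_le (a := (d z).toNNReal))
      obtain ⟨h1, h2, h3, h4⟩ := hsp m z hlt
      exact ⟨h1, h2, h3, h4.trans (lengthBound_mono (by gcongr))⟩

end Main

end UrbanMetric

end

theorem mainTheorem5 (n : ℕ) (S : Set (EuclideanSpace ℝ (Fin n))) (a : ℝ≥0∞)
    (b : EuclideanSpace ℝ (Fin n) → ℝ≥0)
    (hS_sub : S ⊆ UrbanMetric.cube n)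
    (hS_rect : UrbanMetric.CountablyOneRectifiable S)
    (hS_meas : MeasurableSet S)
    (hb_lsc : LowerSemicontinuousOn b S)
    (hb_le : ∀ z ∈ S, (b z : ℝ≥0∞) ≤ a)
    (hfin : ∀ l : ℝ≥0∞, l < a → μH[1] (UrbanMetric.sublevel S b l) < ⊤) :
    ∃ ρ : UrbanMetric.cube n × UrbanMetric.cube n → UrbanMetric.Theta n,
      Measurable ρ ∧
      ∀ x y : UrbanMetric.cube n,
        -- every representative of the class `ρ (x, y)`
        ∀ γ : UrbanMetric.LipPath n, UrbanMetric.pathClass γ = ρ (x, y) →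
          UrbanMetric.pathCost S a b γ.toFun = UrbanMetric.urbanDist S a b x y ∧
          γ.toFun 0 = x ∧ γ.toFun 1 = y ∧
          UrbanMetric.arcLength γ.toFun ≤
            UrbanMetric.lengthBound S a b (UrbanMetric.urbanDist S a b x y + 1) := by
  have hf := UrbanMetric.measurable_friction hS_meas hb_lsc hb_le
  exact UrbanMetric.exists_of_measurable_selection hf
    (UrbanMetric.exists_measurable_representative hS_sub hS_meas hf hb_le hfin)
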